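/- **Theorem (Classical linear equations method).** Let $d\ge 1$, $L,T,\alpha,\zeta>0$, $0<\epsilon<1$. Let $u:\mathbb{R}^d\times[0,T]\to\mathbb{R}$ be $L$-periodic in each space variable, with space derivatives up to order $4$ that are continuous in $(\mathbf{x},t)$, and suppose that $$\frac{\partial u}{\partial t}=\alpha\sum_{i=1}^d\frac{\partial^2u}{\partial x_i^2}\ \text{ on }\mathbb{R}^d\times[0,T],\qquad \left|\frac{\partial^4u}{\partial x_i^2\partial x_j^2}\right|\le\frac{\zeta}{L^d}\ \text{ on }[0,L]^d\times[0,T]\text{ for all }i,j.$$ Put $\bar n=L\sqrt{d\alpha\zeta T/(3\epsilon)}$ and $\bar m=2T^2d^2\alpha^2\zeta/(3\epsilon)$, and let $n=\lceil\bar n\rceil$, $\Delta x=L/n$, $m=\lceil 2d\alpha Tn^2/L^2\rceil$, $\Delta t=T/m$ (if $\bar n$ and $\bar m$ are integers, then $n=\bar n$ and $m=\bar m$). Let $G$ be the set of the points $(\mathbf{k}\Delta x,j\Delta t)$ with $\mathbf{k}\in\{0,\dots,n\}^d$ and $j\in\{0,\dots,m\}$. On the periodic grid with $n^d$ points let $$(\mathcal{L}v)(\mathbf{x})=\Big(1-\frac{2d\alpha\Delta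 t}{\Delta x^2}\Big)v(\mathbf{x})+\frac{\alpha\Delta t}{\Delta x^2}\sum_{i=1}^d\big(v(\mathbf{x}+\Delta x\,\mathbf{e}_i)+v(\mathbf{x}-\Delta x\,\mathbf{e}_i)\big),$$ and consider the forward-time central-space (FTCS) block system $$\mathbf{w}_1=\mathcal{L}\mathbf{u}_0,\qquad \mathbf{w}_{j+1}-\mathcal{L}\mathbf{w}_j=0\quad(1\le j<m),$$ where $\mathbf{u}_0$ is the vector of the values $u(\mathbf{x},0)$ at the grid points. There is a classical algorithm (one program of a random-access machine with exact real arithmetic and unit cost per operation) that, given $d,L,T,\alpha,\zeta,\epsilon$ and access to exact values of $u(\cdot,0)$ at points of its choice, outputs $n$, $m$ and an approximate solution $\widetilde u(\mathbf{x},t)$, $(\mathbf{x},t)\in G$, such that $$|\widetilde u(\mathbf{x},t)-u(\mathbf{x},t)|\le\frac{\epsilon}{L^d}\quad\text{for all }(\mathbf{x},t)\in G,$$ and such that the vector $(\widetilde{\mathbf{u}}_1,\dots,\widetilde{\mathbf{u}}_m)$ is within $\ell_2$ distance $\epsilon/L^d$ of a solution of the FTCS block system, in time $$O\left(3^{-d/2}\,T^{d/2+3}\,L^d\left(\frac{\zeta}{\epsilon}\right)^{d/2+3/2}d^{\,d/2+4}\,\alpha^{d/2+3}\,\log\!\left(\frac{Td\alpha\zeta^{1/2}}{\epsilon}\right)\right)$$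 whenever $\bar m\ge1$ and rounding $\bar n$ up costs at most a constant factor in $n^d$. Precisely: for every real $K$ there is a constant $C$, depending on $K$ only, such that the running time is at most $C$ times the displayed expression for all $d,L,T,\alpha,\zeta,\epsilon,u$ as above with $\bar m\ge1$ and $n^d\le K\,\bar n^{\,d}$ (for $K=1$ this covers all cases where $\bar n$ is an integer), and the output is correct in all these cases. -/

import Mathlib

open Set

/-! ### The machine model: a real random-access machine with a step count

The machine has natural-number registers and arrays (for counters and addresses), real registers and
arrays (for data), exact arithmetic `+, -, *, /` and comparison on reals, `+, -, *` and comparison on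
naturals, the inclusion of the naturals into the reals (there is no rounding from reals to naturals),
and an instruction that evaluates a given real function at a point stored in an array. Every
instruction costs one step, plus one step for each node of the expressions that it evaluates. -/

/-- A machine configuration. -/
structure RAMState where
  nreg : ℕ → ℕ
  rreg : ℕ → ℝ
  narr : ℕ → ℕ → ℕ
  rarr : ℕ → ℕ → ℝ

/-- Natural-number expressions (`sub` is truncated); `get a e` reads entry `e` of array `a`. -/
inductive NExp where
  | const (k : ℕ)
  | reg (i : ℕ)
  | get (a : ℕ) (e : NExp)
  | add (e f : NExp)
  | sub (e f : NExp)
  | mul (e f : NExp)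

def NExp.eval (s : RAMState) : NExp → ℕ
  | .const k => k
  | .reg i => s.nreg i
  | .get a e => s.narr a (e.eval s)
  | .add e f => e.eval s + f.eval s
  | .sub e f => e.eval s - f.eval s
  | .mul e f => e.eval s * f.eval s

def NExp.cost : NExp → ℕ
  | .const _ => 1
  | .reg _ => 1
  | .get _ e => e.cost + 1
  | .add e f => e.cost + f.cost + 1
  | .sub e f => e.cost + f.cost + 1
  | .mul e f => e.cost + f.cost + 1

/-- Real expressions; `cast e` is a natural number read as a real one. -/
inductive RExp where
  | cast (e : NExp)
  | reg (i : ℕ)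
  | get (a : ℕ) (e : NExp)
  | add (e f : RExp)
  | sub (e f : RExp)
  | mul (e f : RExp)
  | div (e f : RExp)

noncomputable def RExp.eval (s : RAMState) : RExp → ℝ
  | .cast e => (e.eval s : ℝ)
  | .reg i => s.rreg i
  | .get a e => s.rarr a (e.eval s)
  | .add e f => e.eval s + f.eval s
  | .sub e f => e.eval s - f.eval s
  | .mul e f => e.eval s * f.eval s
  | .div e f => e.eval s / f.eval s

def RExp.cost : RExp → ℕ
  | .cast e => e.cost + 1
  | .reg _ => 1
  | .get _ e => e.cost + 1
  | .add e f => e.cost + f.cost + 1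
  | .sub e f => e.cost + f.cost + 1
  | .mul e f => e.cost + f.cost + 1
  | .div e f => e.cost + f.cost + 1

/-- Tests: strict comparison of naturals, or of reals. -/
inductive RAMTest where
  | nlt (e f : NExp)
  | rlt (e f : RExp)

def RAMTest.holds (s : RAMState) : RAMTest → Prop
  | .nlt e f => e.eval s < f.eval s
  | .rlt e f => e.eval s < f.eval s

def RAMTest.cost : RAMTest → ℕ
  | .nlt e f => e.cost + f.cost
  | .rlt e f => e.cost + f.cost

/-- Programs. `nset`, `rset` assign to a register, `nput`, `rput` to an array entry, and `query r a`
puts into real register `r` the value of the oracle at the point stored in real array `a`. -/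
inductive RAMProg where
  | skip
  | nset (i : ℕ) (e : NExp)
  | rset (i : ℕ) (e : RExp)
  | nput (a : ℕ) (p e : NExp)
  | rput (a : ℕ) (p : NExp) (e : RExp)
  | query (r a : ℕ)
  | seq (c c' : RAMProg)
  | branch (b : RAMTest) (c c' : RAMProg)
  | loop (b : RAMTest) (c : RAMProg)

/-- `RAMExec O c s s' t`: with oracle `O`, the program `c` started in `s` halts in `s'` after exactly
`t` steps. (`loop b c` repeats `c` while `b` holds.) -/
inductive RAMExec (O : (ℕ → ℝ) → ℝ) : RAMProg → RAMState → RAMState → ℕ → Prop where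
  | skip (s : RAMState) : RAMExec O .skip s s 1
  | nset (s : RAMState) (i : ℕ) (e : NExp) :
      RAMExec O (.nset i e) s { s with nreg := Function.update s.nreg i (e.eval s) } (1 + e.cost)
  | rset (s : RAMState) (i : ℕ) (e : RExp) :
      RAMExec O (.rset i e) s { s with rreg := Function.update s.rreg i (e.eval s) } (1 + e.cost)
  | nput (s : RAMState) (a : ℕ) (p e : NExp) :
      RAMExec O (.nput a p e) s
        { s with narr := Function.update s.narr a
                          (Function.update (s.narr a) (p.eval s) (e.eval s)) }
        (1 + p.cost + e.cost)
  | rput (s : RAMState) (a : ℕ) (p : NExp) (e : RExp) :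
      RAMExec O (.rput a p e) s
        { s with rarr := Function.update s.rarr a
                          (Function.update (s.rarr a) (p.eval s) (e.eval s)) }
        (1 + p.cost + e.cost)
  | query (s : RAMState) (r a : ℕ) :
      RAMExec O (.query r a) s { s with rreg := Function.update s.rreg r (O (s.rarr a)) } 1
  | seq {c c' : RAMProg} {s s' s'' : RAMState} {t t' : ℕ} :
      RAMExec O c s s' t → RAMExec O c' s' s'' t' → RAMExec O (.seq c c') s s'' (t + t')
  | branch_true {b : RAMTest} {c c' : RAMProg} {s s' : RAMState} {t : ℕ} :
      b.holds s → RAMExec O c s s' t → RAMExec O (.branch b c c') s s' (1 + b.cost + t)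
  | branch_false {b : RAMTest} {c c' : RAMProg} {s s' : RAMState} {t : ℕ} :
      ¬ b.holds s → RAMExec O c' s s' t → RAMExec O (.branch b c c') s s' (1 + b.cost + t)
  | loop_done {b : RAMTest} {c : RAMProg} {s : RAMState} :
      ¬ b.holds s → RAMExec O (.loop b c) s s (1 + b.cost)
  | loop_step {b : RAMTest} {c : RAMProg} {s s' s'' : RAMState} {t t' : ℕ} :
      b.holds s → RAMExec O c s s' t → RAMExec O (.loop b c) s' s'' t' →
      RAMExec O (.loop b c) s s'' (1 + b.cost + t + t')

/-- The initial configuration: `d` in natural register 0 and `L, T, α, ζ, ε` in real registers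
0, ..., 4; everything else is zero. -/
noncomputable def heatInput (d : ℕ) (L T α ζ ε : ℝ) : RAMState where
  nreg := fun i => if i = 0 then d else 0
  rreg := fun i =>
    if i = 0 then L else if i = 1 then T else if i = 2 then α else if i = 3 then ζ
    else if i = 4 then ε else 0
  narr := fun _ _ => 0
  rarr := fun _ _ => 0

/-! ### The heat equation with periodic boundary conditions -/

/-- The partial derivative `∂f/∂xᵢ`. -/
noncomputable def pd {d : ℕ} (i : Fin d) (f : (Fin d → ℝ) → ℝ) : (Fin d → ℝ) → ℝ :=
  fun x => lineDeriv ℝ f x (Pi.single i 1)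

/-- `u` is a classical solution of `∂u/∂t = α ∑ᵢ ∂²u/∂xᵢ²` for `0 ≤ t ≤ T`, with period `L` in each
space variable, whose space derivatives up to order 4 exist and are continuous in `(x, t)`.
(At `t = 0` and `t = T` the time derivative is one-sided.) -/
structure IsPeriodicHeatSolution {d : ℕ} (L T α : ℝ) (u : (Fin d → ℝ) → ℝ → ℝ) : Prop where
  periodic : ∀ t ∈ Icc 0 T, ∀ (x : Fin d → ℝ) (i : Fin d), u (x + Pi.single i L) t = u x t
  smooth : ∀ t ∈ Icc 0 T, ContDiff ℝ 4 (fun x => u x t)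
  continuous : ∀ k : ℕ, k ≤ 4 →
    ContinuousOn (fun p : (Fin d → ℝ) × ℝ => iteratedFDeriv ℝ k (fun x => u x p.2) p.1)
      (univ ×ˢ Icc 0 T)
  heat : ∀ (x : Fin d → ℝ), ∀ t ∈ Icc 0 T,
    HasDerivWithinAt (fun s => u x s) (α * ∑ i, pd i (pd i (fun y => u y t)) x) (Icc 0 T) t

/-- The smoothness bound `|∂⁴u/∂xᵢ²∂xⱼ²| ≤ ζ / L^d` on `[0,L]^d × [0,T]`, for all `i, j`. -/
def FourthDerivBound {d : ℕ} (L T ζ : ℝ) (u : (Fin d → ℝ) → ℝ → ℝ) : Prop :=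
  ∀ i j : Fin d, ∀ x ∈ Icc (0 : Fin d → ℝ) (fun _ => L), ∀ t ∈ Icc 0 T,
    |pd i (pd i (pd j (pd j (fun y => u y t)))) x| ≤ ζ / L ^ d

/-! ### The discretisation -/

/-- The real number `L √(d α ζ T / (3 ε))` of space intervals. -/
noncomputable def spaceSteps (d : ℕ) (L T α ζ ε : ℝ) : ℝ :=
  L * √(d * α * ζ * T / (3 * ε))

/-- The real number `2 T² d² α² ζ / (3 ε)` of time intervals. -/
noncomputable def timeSteps (d : ℕ) (T α ζ ε : ℝ) : ℝ :=
  2 * T ^ 2 * (d : ℝ) ^ 2 * α ^ 2 * ζ / (3 * ε)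

/-- The number `n` of grid intervals in each space direction: `spaceSteps`, rounded up. -/
noncomputable def gridN (d : ℕ) (L T α ζ ε : ℝ) : ℕ :=
  ⌈spaceSteps d L T α ζ ε⌉₊

/-- The number `m` of time steps: the least one with `Δt ≤ Δx² / (2 d α)`, where `Δx = L / n` and
`Δt = T / m`. If `spaceSteps` and `timeSteps` are integers, then `m = timeSteps`. -/
noncomputable def gridM (d : ℕ) (L T α ζ ε : ℝ) : ℕ :=
  ⌈2 * d * α * T * (gridN d L T α ζ ε : ℝ) ^ 2 / L ^ 2⌉₊

/-- The grid point `k + eᵢ`, cyclically. -/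
def gridShift {d n : ℕ} (i : Fin d) (k : Fin d → Fin n) : Fin d → Fin n :=
  Function.update k i (finRotate n (k i))

/-- The one-step operator `ℒ` of the forward-time central-space scheme on the periodic grid, where
`r = α Δt / Δx²`: `(ℒ v)(k) = (1 - 2dr) v(k) + r ∑ᵢ (v(k + eᵢ) + v(k - eᵢ))`. -/
def ftcsStep (d n : ℕ) (r : ℝ) : Matrix (Fin d → Fin n) (Fin d → Fin n) ℝ :=
  fun k k' => (if k' = k then 1 - 2 * d * r else 0) +
    ∑ i, ((if k' = gridShift i k then r else 0) + (if k = gridShift i k' then r else 0))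

/-- The block matrix with `I` on the diagonal and `-ℒ` below it. Block `j : Fin m` belongs to the
time `(j + 1) Δt`. -/
def ftcsMatrix (d n m : ℕ) (r : ℝ) :
    Matrix (Fin m × (Fin d → Fin n)) (Fin m × (Fin d → Fin n)) ℝ :=
  fun p q => if p = q then 1
    else if (p.1 : ℕ) = (q.1 : ℕ) + 1 then - ftcsStep d n r p.2 q.2 else 0

/-- The right-hand side `(ℒ v₀, 0, ..., 0)` of the block system. -/
def ftcsRhs (d n m : ℕ) (r : ℝ) (v₀ : (Fin d → Fin n) → ℝ) : Fin m × (Fin d → Fin n) → ℝ :=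
  fun p => if (p.1 : ℕ) = 0 then (ftcsStep d n r).mulVec v₀ p.2 else 0

/-- The space point `k Δx`. -/
noncomputable def gridPoint {d : ℕ} (L : ℝ) (n : ℕ) (k : Fin d → ℕ) : Fin d → ℝ :=
  fun i => k i * (L / n)

/-- The value that the configuration `s` holds for the time `j Δt` and the space point `k Δx`: real
array 0 lists the values time after time, and for each time in the order of the base-`n` number with
digits `kᵢ`. Coordinates are taken modulo `n`, as `0` and `L` are the same place. -/
def readGrid {d : ℕ} (s : RAMState) (n j : ℕ) (k : Fin d → ℕ) : ℝ :=
  s.rarr 0 (j * n ^ d + ∑ i : Fin d, (k i % n) * n ^ (i : ℕ))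

/-- The bound on the running time, up to a constant factor. -/
noncomputable def linEqTime (d : ℕ) (L T α ζ ε : ℝ) : ℝ :=
  (3 : ℝ) ^ (-(d : ℝ) / 2) * T ^ ((d : ℝ) / 2 + 3) * L ^ d * (ζ / ε) ^ ((d : ℝ) / 2 + 3 / 2) *
    (d : ℝ) ^ ((d : ℝ) / 2 + 4) * α ^ ((d : ℝ) / 2 + 3) * Real.log (T * d * α * √ζ / ε)

/-! ### Second differences -/

/-! The algorithm is explicit time stepping: forward substitution solves the block system exactly,
so what remains is to bound the discretisation error and to count steps.

Accuracy is consistency plus stability. Write `B = ζ / L ^ d`, `h = Δx`, `δ = Δt`. Taylor expansion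
in space costs `B h ^ 4 / 12` per direction. In time no second derivative is assumed; instead the
equation transfers space regularity to time. The time derivative of a spatial second difference of
`u` is `α` times that of the Laplacian, which fourth derivatives control; dividing by `h ^ 2` and
letting `h → 0` makes second space derivatives Lipschitz in time (`abs_pd_pd_sub_le`). This yields
the one-step error in `abs_truncation_le`. When `2 d r ≤ 1`, the step is an average with nonnegative
weights and does not increase the maximum norm (`abs_ftcsStep_mulVec_le`), so errors merely add up
(`abs_ftcs_sub_le`), and the choice of `n` and `m` brings the sum below `ε / L ^ d`
(`total_error_le`).

Cost is of order `n ^ d * m * d`, one visit per time step, grid point and direction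
(`FTCS.program_meets`). The machine has neither rounding nor integer division, so `n` and `m` are
found by counting, and quotients and remainders are tabulated. The claimed time exceeds a multiple
of `n̄ ^ d * m̄ * d` (`linEqTime_ge`), and rounding costs a factor depending on `K` only
(`gridN_pow_mul_gridM_le`). -/

/-- Integration of a power bound on the derivative. -/
theorem abs_le_of_abs_deriv_le_pow {φ φ' : ℝ → ℝ} {b C : ℝ} (k : ℕ) (h0 : φ 0 = 0)
    (hφ : ∀ x ∈ Icc 0 b, HasDerivWithinAt φ (φ' x) (Icc 0 b) x)
    (hb : ∀ x ∈ Icc 0 b, |φ' x| ≤ C * x ^ k) {x : ℝ} (hx : x ∈ Icc 0 b) :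
    |φ x| ≤ C / (k + 1) * x ^ (k + 1) := by
  have hk : (k : ℝ) + 1 ≠ 0 := by positivity
  refine image_norm_le_of_norm_deriv_right_le_deriv_boundary (f' := φ') (a := 0) (b := b)
    (B := fun x => C / (k + 1) * x ^ (k + 1)) (B' := fun x => C * x ^ k)
    (fun y hy => (hφ y hy).continuousWithinAt) ?_ (by simp [h0]) ?_ ?_ hx
  · intro y hy
    refine (hφ y ⟨hy.1, hy.2.le⟩).mono_of_mem_nhdsWithin ?_
    exact mem_nhdsWithin.2 ⟨Iio b, isOpen_Iio, hy.2, fun z hz => ⟨hy.1.trans hz.2, hz.1.le⟩⟩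
  · intro y
    have := (hasDerivAt_pow (k + 1) y).const_mul (C / ((k : ℝ) + 1))
    refine this.congr_deriv ?_
    rw [Nat.add_sub_cancel]
    push_cast
    field_simp
  · intro y hy
    exact hb y ⟨hy.1, hy.2.le⟩

theorem abs_le_of_abs_hasDerivAt_le_pow {φ φ' : ℝ → ℝ} {C : ℝ} (k : ℕ) (h0 : φ 0 = 0)
    (hφ : ∀ x, HasDerivAt φ (φ' x) x) (hb : ∀ x, 0 ≤ x → |φ' x| ≤ C * x ^ k) {x : ℝ} (hx : 0 ≤ x) :
    |φ x| ≤ C / (k + 1) * x ^ (k + 1) :=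
  abs_le_of_abs_deriv_le_pow (b := x) k h0 (fun y _ => (hφ y).hasDerivWithinAt)
    (fun y hy => hb y hy.1) ⟨hx, le_rfl⟩

theorem HasDerivAt.comp_neg' {g : ℝ → ℝ} {g' x : ℝ} (h : HasDerivAt g g' (-x)) :
    HasDerivAt (fun y => g (-y)) (-g') x := by
  simpa [Function.comp_def] using h.scomp x (hasDerivAt_neg x)

theorem abs_secondDiff_le {g g₁ g₂ : ℝ → ℝ} {M h : ℝ} (hg : ∀ x, HasDerivAt g (g₁ x) x)
    (hg₁ : ∀ x, HasDerivAt g₁ (g₂ x) x) (hM : ∀ x, |g₂ x| ≤ M) (hh : 0 ≤ h) :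
    |g h + g (-h) - 2 * g 0| ≤ M * h ^ 2 := by
  have h1 : ∀ x, 0 ≤ x → |g₁ x - g₁ (-x)| ≤ 2 * M * x ^ 1 := by
    intro x hx
    have := abs_le_of_abs_hasDerivAt_le_pow (φ := fun x => g₁ x - g₁ (-x))
      (φ' := fun x => g₂ x - -g₂ (-x)) (C := 2 * M) 0 (by simp)
      (fun x => (hg₁ x).fun_sub (hg₁ (-x)).comp_neg') (fun x _ => by
        have := abs_add_le (g₂ x) (g₂ (-x))
        have := hM x; have := hM (-x); simp only [sub_neg_eq_add, pow_zero, mul_one]; linarith) hx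
    simpa using this
  have := abs_le_of_abs_hasDerivAt_le_pow (φ := fun x => g x + g (-x) - 2 * g 0)
      (φ' := fun x => g₁ x - g₁ (-x)) (C := 2 * M) 1 (by simp; ring)
      (fun x => by simpa [sub_eq_add_neg] using ((hg x).fun_add (hg (-x)).comp_neg').sub_const (2 * g 0)) h1 hh
  refine this.trans (le_of_eq ?_)
  norm_num

/-- Differentiating the remainder twice in `h` gives the second difference of `g₂`, to which
`abs_secondDiff_le` applies; integrating `M x ^ 2` twice from `0` produces `M / 3` and then `M /
12`. -/
theorem abs_secondDiff_sub_le {g g₁ g₂ g₃ g₄ : ℝ → ℝ} {M h : ℝ} (hg : ∀ x, HasDerivAt g (g₁ x) x)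
    (hg₁ : ∀ x, HasDerivAt g₁ (g₂ x) x) (hg₂ : ∀ x, HasDerivAt g₂ (g₃ x) x)
    (hg₃ : ∀ x, HasDerivAt g₃ (g₄ x) x) (hM : ∀ x, |g₄ x| ≤ M) (hh : 0 ≤ h) :
    |g h + g (-h) - 2 * g 0 - h ^ 2 * g₂ 0| ≤ M / 12 * h ^ 4 := by
  have h2 : ∀ x, 0 ≤ x → |g₂ x + g₂ (-x) - 2 * g₂ 0| ≤ M * x ^ 2 :=
    fun x hx => abs_secondDiff_le hg₂ hg₃ hM hx
  have h3 : ∀ x, 0 ≤ x → |g₁ x - g₁ (-x) - x * (2 * g₂ 0)| ≤ M / 3 * x ^ 3 := by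
    intro x hx
    have := abs_le_of_abs_hasDerivAt_le_pow (φ := fun x => g₁ x - g₁ (-x) - x * (2 * g₂ 0))
      (φ' := fun x => g₂ x + g₂ (-x) - 2 * g₂ 0) (C := M) 2 (by simp)
      (fun x => by
        simpa using ((hg₁ x).fun_sub (hg₁ (-x)).comp_neg').fun_sub
          ((hasDerivAt_id x).mul_const (2 * g₂ 0))) h2 hx
    refine this.trans (le_of_eq ?_)
    norm_num
  have := abs_le_of_abs_hasDerivAt_le_pow (φ := fun x => g x + g (-x) - 2 * g 0 - x ^ 2 * g₂ 0)
      (φ' := fun x => g₁ x - g₁ (-x) - x * (2 * g₂ 0)) (C := M / 3) 3 (by simp; ring)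
      (fun x => by
        have := (((hg x).fun_add (hg (-x)).comp_neg').sub_const (2 * g 0)).fun_sub
          ((hasDerivAt_pow 2 x).mul_const (g₂ 0))
        refine this.congr_deriv ?_
        norm_num
        ring) h3 hh
  refine this.trans (le_of_eq ?_)
  norm_num [div_div]

/-! ### Partial derivatives -/

section pd
variable {d : ℕ} {f g : (Fin d → ℝ) → ℝ}

theorem pd_eq_fderiv (hf : Differentiable ℝ f) (i : Fin d) :
    pd i f = fun x => fderiv ℝ f x (Pi.single i 1) := by
  funext x
  exact (hf x).lineDeriv_eq_fderiv

theorem ContDiff.pd {k : ℕ} (hf : ContDiff ℝ (k + 1 : ℕ) f) (i : Fin d) :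
    ContDiff ℝ k (pd i f) := by
  rw [pd_eq_fderiv (hf.differentiable (by simp))]
  exact (hf.fderiv_right (m := k) (by simp)).clm_apply contDiff_const

theorem hasDerivAt_line (hf : Differentiable ℝ f) (x : Fin d → ℝ) (i : Fin d) (s : ℝ) :
    HasDerivAt (fun s : ℝ => f (x + s • Pi.single i 1)) (pd i f (x + s • Pi.single i 1)) s := by
  rw [pd_eq_fderiv hf]
  have h : HasDerivAt (fun s : ℝ => x + s • (Pi.single i 1 : Fin d → ℝ)) (Pi.single i 1) s := by
    simpa using ((hasDerivAt_id s).smul_const (Pi.single i 1 : Fin d → ℝ)).const_add x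
  exact (hf _).hasFDerivAt.comp_hasDerivAt s h

theorem pd_sum {ι : Type*} (S : Finset ι) {F : ι → (Fin d → ℝ) → ℝ}
    (hF : ∀ j ∈ S, Differentiable ℝ (F j)) (i : Fin d) :
    pd i (fun x => ∑ j ∈ S, F j x) = fun x => ∑ j ∈ S, pd i (F j) x := by
  rw [pd_eq_fderiv (Differentiable.fun_sum hF)]
  funext x
  rw [fderiv_fun_sum (fun j hj => hF j hj x)]
  simp only [FunLike.coe_sum, Finset.sum_apply]
  exact Finset.sum_congr rfl fun j hj => by rw [pd_eq_fderiv (hF j hj)]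

theorem Function.Periodic.pd {v : Fin d → ℝ} (hf : Function.Periodic f v) (i : Fin d) :
    Function.Periodic (pd i f) v := by
  intro x
  unfold _root_.pd lineDeriv
  congr 1
  funext t
  rw [add_right_comm, hf]

/-- The central second difference of `f` in direction `i`, not divided by `h ^ 2`. -/
noncomputable def secondDiff (i : Fin d) (h : ℝ) (f : (Fin d → ℝ) → ℝ) (x : Fin d → ℝ) : ℝ :=
  f (x + h • Pi.single i 1) + f (x + (-h) • Pi.single i 1) - 2 * f x

theorem abs_secondDiff_le_of_pd {M h : ℝ} (hf : ContDiff ℝ 2 f) (i : Fin d)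
    (hM : ∀ x, |pd i (pd i f) x| ≤ M) (hh : 0 ≤ h) (x : Fin d → ℝ) :
    |secondDiff i h f x| ≤ M * h ^ 2 := by
  have h1 : ContDiff ℝ 1 (pd i f) := ContDiff.pd (k := 1) hf i
  have := abs_secondDiff_le (hasDerivAt_line (hf.differentiable (by simp)) x i)
    (hasDerivAt_line (h1.differentiable (by simp)) x i) (fun s => hM _) hh
  simpa [secondDiff] using this

theorem abs_secondDiff_sub_le_of_pd {M h : ℝ} (hf : ContDiff ℝ 4 f) (i : Fin d)
    (hM : ∀ x, |pd i (pd i (pd i (pd i f))) x| ≤ M) (hh : 0 ≤ h) (x : Fin d → ℝ) :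
    |secondDiff i h f x - h ^ 2 * pd i (pd i f) x| ≤ M / 12 * h ^ 4 := by
  have h1 : ContDiff ℝ 3 (pd i f) := ContDiff.pd (k := 3) hf i
  have h2 : ContDiff ℝ 2 (pd i (pd i f)) := ContDiff.pd (k := 2) h1 i
  have h3 : ContDiff ℝ 1 (pd i (pd i (pd i f))) := ContDiff.pd (k := 1) h2 i
  have := abs_secondDiff_sub_le (hasDerivAt_line (hf.differentiable (by simp)) x i)
    (hasDerivAt_line (h1.differentiable (by simp)) x i)
    (hasDerivAt_line (h2.differentiable (by simp)) x i)
    (hasDerivAt_line (h3.differentiable (by simp)) x i) (fun s => hM _) hh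
  simpa [secondDiff] using this

end pd

/-! ### Periodic solutions of the heat equation -/

section heat
variable {d : ℕ} {L T α ζ : ℝ} {u : (Fin d → ℝ) → ℝ → ℝ}

theorem periodic_int_mul {f : (Fin d → ℝ) → ℝ} (hf : ∀ x i, f (x + Pi.single i L) = f x)
    (c : Fin d → ℤ) : Function.Periodic f (fun i => c i * L) := by
  have key : ∀ S : Finset (Fin d), Function.Periodic f (∑ i ∈ S, c i • Pi.single i L) := by
    intro S
    induction S using Finset.induction_on with
    | empty => intro x; simp
    | insert a S ha ih =>
      rw [Finset.sum_insert ha]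
      exact Function.Periodic.add_period (Function.Periodic.zsmul (fun x => hf x a) (c a)) ih
  convert key Finset.univ using 1
  funext i
  simp [Finset.sum_apply, Pi.single_apply]

/-- Subtracting `⌊x i / L⌋` periods in each coordinate moves any point into the cube. -/
theorem abs_le_of_periodic {g : (Fin d → ℝ) → ℝ} {B : ℝ} (hL : 0 < L)
    (hg : ∀ x i, g (x + Pi.single i L) = g x)
    (hB : ∀ x ∈ Icc (0 : Fin d → ℝ) (fun _ => L), |g x| ≤ B) (x : Fin d → ℝ) : |g x| ≤ B := by
  have h := periodic_int_mul hg (fun i => -⌊x i / L⌋) x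
  rw [← h]
  refine hB _ ⟨fun i => ?_, fun i => ?_⟩
  · have := Int.floor_le (x i / L)
    have := mul_le_mul_of_nonneg_right this hL.le
    rw [div_mul_cancel₀ _ hL.ne'] at this
    simp only [Pi.zero_apply, Pi.add_apply]; push_cast; linarith
  · have := (Int.lt_floor_add_one (x i / L)).le
    have := mul_le_mul_of_nonneg_right this hL.le
    rw [div_mul_cancel₀ _ hL.ne'] at this
    simp only [Pi.add_apply]; push_cast; linarith

theorem FourthDerivBound.abs_le (hL : 0 < L) (hu : IsPeriodicHeatSolution L T α u)
    (hζ : FourthDerivBound L T ζ u) (i j : Fin d) (x : Fin d → ℝ) {t : ℝ} (ht : t ∈ Icc 0 T) :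
    |pd i (pd i (pd j (pd j (fun y => u y t)))) x| ≤ ζ / L ^ d := by
  refine abs_le_of_periodic hL (fun x k => ?_) (fun x hx => hζ i j x hx t ht) x
  have hp : Function.Periodic (fun y => u y t) (Pi.single k L) := fun x => hu.periodic t ht x k
  exact (((hp.pd j).pd j).pd i).pd i x

/-- The Laplacian. -/
noncomputable def laplacian (f : (Fin d → ℝ) → ℝ) (x : Fin d → ℝ) : ℝ := ∑ i, pd i (pd i f) x

theorem contDiff_laplacian {f : (Fin d → ℝ) → ℝ} (hf : ContDiff ℝ 4 f) :
    ContDiff ℝ 2 (laplacian f) :=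
  ContDiff.sum fun i _ => ContDiff.pd (k := 2) (ContDiff.pd (k := 3) hf i) i

/-- The summands have exactly the order of differentiation bounded by `FourthDerivBound`, so partial
derivatives never need to be commuted. -/
theorem pd_pd_laplacian {f : (Fin d → ℝ) → ℝ} (hf : ContDiff ℝ 4 f) (i : Fin d) (x : Fin d → ℝ) :
    pd i (pd i (laplacian f)) x = ∑ j, pd i (pd i (pd j (pd j f))) x := by
  have h2 : ∀ j, ContDiff ℝ 2 (pd j (pd j f)) :=
    fun j => ContDiff.pd (k := 2) (ContDiff.pd (k := 3) hf j) j
  have h1 : ∀ j, ContDiff ℝ 1 (pd i (pd j (pd j f))) := fun j => ContDiff.pd (k := 1) (h2 j) i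
  unfold laplacian
  rw [pd_sum _ (fun j _ => (h2 j).differentiable (by simp)),
    pd_sum _ (fun j _ => (h1 j).differentiable (by simp))]

/-- Replaces a bound on the second time derivative. Second derivatives are approximated by second
differences, which are differentiable in time by the heat equation. -/
theorem abs_pd_pd_sub_le (hL : 0 < L) (hα : 0 < α)
    (hu : IsPeriodicHeatSolution L T α u) (hζ : FourthDerivBound L T ζ u) (i : Fin d)
    (x : Fin d → ℝ) {s t : ℝ} (hs : s ∈ Icc 0 T) (ht : t ∈ Icc 0 T) :
    |pd i (pd i (fun y => u y t)) x - pd i (pd i (fun y => u y s)) x| ≤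
      α * (d * (ζ / L ^ d)) * |t - s| := by
  set B := ζ / L ^ d with hB
  have hB0 : 0 ≤ B := (abs_nonneg _).trans (hζ.abs_le hL hu i i x hs)
  have key : ∀ h : ℝ, 0 < h →
      |pd i (pd i (fun y => u y t)) x - pd i (pd i (fun y => u y s)) x| ≤
        α * (d * B) * |t - s| + B / 6 * h ^ 2 := by
    intro h hh
    have e1 := abs_secondDiff_sub_le_of_pd (hu.smooth t ht) i (fun x => hζ.abs_le hL hu i i x ht)
      hh.le x
    have e2 := abs_secondDiff_sub_le_of_pd (hu.smooth s hs) i (fun x => hζ.abs_le hL hu i i x hs)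
      hh.le x
    have e3 : |secondDiff i h (fun y => u y t) x - secondDiff i h (fun y => u y s) x| ≤
        α * (d * B * h ^ 2) * |t - s| := by
      -- Mean value inequality in time for the second difference at fixed `h`.
      refine (convex_Icc 0 T).norm_image_sub_le_of_norm_hasDerivWithin_le
        (f := fun τ => secondDiff i h (fun y => u y τ) x)
        (f' := fun τ => α * secondDiff i h (laplacian fun y => u y τ) x) ?_ ?_ hs ht
      · intro τ hτ
        have := ((hu.heat (x + h • Pi.single i 1) τ hτ).fun_add
          (hu.heat (x + (-h) • Pi.single i 1) τ hτ)).fun_sub ((hu.heat x τ hτ).const_mul 2)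
        refine (this.congr_deriv ?_).congr (fun _ _ => rfl) rfl
        unfold secondDiff laplacian
        ring
      · intro τ hτ
        rw [Real.norm_eq_abs, abs_mul, abs_of_pos hα]
        refine mul_le_mul_of_nonneg_left ?_ hα.le
        refine abs_secondDiff_le_of_pd (contDiff_laplacian (hu.smooth τ hτ)) i (fun y => ?_) hh.le x
        rw [pd_pd_laplacian (hu.smooth τ hτ)]
        refine (Finset.abs_sum_le_sum_abs _ _).trans ?_
        refine (Finset.sum_le_card_nsmul _ _ B fun j _ => hζ.abs_le hL hu i j y hτ).trans ?_
        simp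
    have h2 : 0 < h ^ 2 := by positivity
    refine le_of_mul_le_mul_left ?_ h2
    rw [← abs_of_pos h2, ← abs_mul, abs_of_pos h2]
    rw [abs_le] at e1 e2 e3 ⊢
    constructor <;> nlinarith
  refine le_of_forall_pos_le_add fun δ hδ => ?_
  -- This `h` makes the extra term `B / 6 * h ^ 2` equal to `B * δ / (B + 1) ≤ δ`; the `+ 1` covers
  -- `B = 0`.
  have hh : 0 < √(6 * δ / (B + 1)) := Real.sqrt_pos.2 (by positivity)
  refine (key _ hh).trans ?_
  rw [Real.sq_sqrt (by positivity)]
  have : B / 6 * (6 * δ / (B + 1)) ≤ δ := by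
    rw [show B / 6 * (6 * δ / (B + 1)) = B * δ / (B + 1) by ring, div_le_iff₀ (by positivity)]
    nlinarith
  linarith

theorem abs_laplacian_sub_le (hL : 0 < L) (hα : 0 < α)
    (hu : IsPeriodicHeatSolution L T α u) (hζ : FourthDerivBound L T ζ u)
    (x : Fin d → ℝ) {s t : ℝ} (hs : s ∈ Icc 0 T) (ht : t ∈ Icc 0 T) :
    |laplacian (fun y => u y t) x - laplacian (fun y => u y s) x| ≤
      α * (d ^ 2 * (ζ / L ^ d)) * |t - s| := by
  unfold laplacian
  rw [← Finset.sum_sub_distrib]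
  refine (Finset.abs_sum_le_sum_abs _ _).trans ?_
  refine (Finset.sum_le_card_nsmul _ _ _
    fun i _ => abs_pd_pd_sub_le hL hα hu hζ i x hs ht).trans (le_of_eq ?_)
  simp
  ring

/-- One forward Euler step for the heat equation. -/
theorem abs_euler_step_le (hL : 0 < L) (hα : 0 < α)
    (hu : IsPeriodicHeatSolution L T α u) (hζ : FourthDerivBound L T ζ u)
    (x : Fin d → ℝ) {t δ : ℝ} (ht : 0 ≤ t) (hδ : 0 ≤ δ) (hT : t + δ ≤ T) :
    |u x (t + δ) - u x t - δ * (α * laplacian (fun y => u y t) x)| ≤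
      α ^ 2 * d ^ 2 * (ζ / L ^ d) / 2 * δ ^ 2 := by
  have htT : t ∈ Icc 0 T := ⟨ht, by linarith⟩
  have := abs_le_of_abs_deriv_le_pow (b := δ) (C := α ^ 2 * d ^ 2 * (ζ / L ^ d)) 1
    (φ := fun τ => u x (t + τ) - u x t - τ * (α * laplacian (fun y => u y t) x))
    (φ' := fun τ => α * laplacian (fun y => u y (t + τ)) x - α * laplacian (fun y => u y t) x)
    (by simp) ?_ ?_ (x := δ) ⟨hδ, le_rfl⟩
  · refine this.trans (le_of_eq ?_)
    norm_num
  · intro τ hτ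
    have hτT : t + τ ∈ Icc 0 T := ⟨by linarith [hτ.1], by linarith [hτ.2]⟩
    have h1 : HasDerivWithinAt (fun τ => u x (t + τ)) (α * laplacian (fun y => u y (t + τ)) x)
        (Icc 0 δ) τ := by
      have := (hu.heat x (t + τ) hτT).scomp τ (h := fun τ => t + τ) (s := Icc 0 δ) (h' := 1)
        ((hasDerivAt_id τ).const_add t).hasDerivWithinAt
        (fun z hz => ⟨by linarith [hz.1], by linarith [hz.2]⟩)
      simpa [laplacian, Function.comp_def] using this
    have h2 := (h1.sub_const (u x t)).fun_sub ((hasDerivWithinAt_id τ (Icc 0 δ)).mul_const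
      (α * laplacian (fun y => u y t) x))
    simpa using h2
  · intro τ hτ
    have hτT : t + τ ∈ Icc 0 T := ⟨by linarith [hτ.1], by linarith [hτ.2]⟩
    rw [← mul_sub, abs_mul, abs_of_pos hα]
    have := abs_laplacian_sub_le hL hα hu hζ x htT hτT
    rw [add_sub_cancel_left, abs_of_nonneg hτ.1] at this
    calc _ ≤ α * (α * (d ^ 2 * (ζ / L ^ d)) * τ) := mul_le_mul_of_nonneg_left this hα.le
      _ = _ := by ring

/-- Truncation error of the forward-time central-space scheme. -/
theorem abs_truncation_le (hL : 0 < L) (hα : 0 < α)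
    (hu : IsPeriodicHeatSolution L T α u) (hζ : FourthDerivBound L T ζ u)
    (x : Fin d → ℝ) {t δ h : ℝ} (ht : 0 ≤ t) (hδ : 0 ≤ δ) (hT : t + δ ≤ T) (hh : 0 < h) :
    |u x (t + δ) - u x t - α * δ / h ^ 2 * ∑ i, secondDiff i h (fun y => u y t) x| ≤
      α * d * (ζ / L ^ d) * δ * (α * d * δ / 2 + h ^ 2 / 12) := by
  have htT : t ∈ Icc 0 T := ⟨ht, by linarith⟩
  have h1 := abs_euler_step_le hL hα hu hζ x ht hδ hT
  have h2 : |∑ i, secondDiff i h (fun y => u y t) x - h ^ 2 * laplacian (fun y => u y t) x| ≤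
      d * ((ζ / L ^ d) / 12 * h ^ 4) := by
    unfold laplacian
    rw [Finset.mul_sum, ← Finset.sum_sub_distrib]
    refine (Finset.abs_sum_le_sum_abs _ _).trans ?_
    refine (Finset.sum_le_card_nsmul _ _ _ fun i _ =>
      abs_secondDiff_sub_le_of_pd (hu.smooth t htT) i
        (fun x => hζ.abs_le hL hu i i x htT) hh.le x).trans (le_of_eq ?_)
    simp
  have h3 : 0 ≤ α * δ / h ^ 2 := by positivity
  have h4 : |α * δ / h ^ 2 * (∑ i, secondDiff i h (fun y => u y t) x -
      h ^ 2 * laplacian (fun y => u y t) x)| ≤ α * δ / h ^ 2 * (d * ((ζ / L ^ d) / 12 * h ^ 4)) := by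
    rw [abs_mul, abs_of_nonneg h3]
    exact mul_le_mul_of_nonneg_left h2 h3
  have e1 : α * δ / h ^ 2 * (d * ((ζ / L ^ d) / 12 * h ^ 4)) =
      α * d * (ζ / L ^ d) * δ * (h ^ 2 / 12) := by
    field_simp
  -- The truncation error is the Euler error in time minus the scaled error of the discrete
  -- Laplacian.
  have e2 : u x (t + δ) - u x t - α * δ / h ^ 2 * ∑ i, secondDiff i h (fun y => u y t) x =
      (u x (t + δ) - u x t - δ * (α * laplacian (fun y => u y t) x)) -
      α * δ / h ^ 2 * (∑ i, secondDiff i h (fun y => u y t) x -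
      h ^ 2 * laplacian (fun y => u y t) x) := by
    field_simp
    ring
  rw [e2]
  rw [e1] at h4
  refine (abs_sub _ _).trans ?_
  linarith

end heat

/-! ### Reasoning about programs -/

/-- Started in `s`, the program `c` halts within `B` steps in a configuration that satisfies `Q`. -/
def Meets (O : (ℕ → ℝ) → ℝ) (c : RAMProg) (s : RAMState) (B : ℕ) (Q : RAMState → Prop) : Prop :=
  ∃ s' t, RAMExec O c s s' t ∧ t ≤ B ∧ Q s'

namespace RAMProg

/-- Programs without branches and loops. -/
def Straight : RAMProg → Prop
  | .seq c c' => c.Straight ∧ c'.Straight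
  | .branch _ _ _ => False
  | .loop _ _ => False
  | _ => True

/-- The effect of a program without branches and loops. -/
noncomputable def denote (O : (ℕ → ℝ) → ℝ) : RAMProg → RAMState → RAMState
  | .skip, s => s
  | .nset i e, s => { s with nreg := Function.update s.nreg i (e.eval s) }
  | .rset i e, s => { s with rreg := Function.update s.rreg i (e.eval s) }
  | .nput a p e, s =>
    { s with narr := Function.update s.narr a
                      (Function.update (s.narr a) (p.eval s) (e.eval s)) }
  | .rput a p e, s =>
    { s with rarr := Function.update s.rarr a
                      (Function.update (s.rarr a) (p.eval s) (e.eval s)) }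
  | .query r a, s => { s with rreg := Function.update s.rreg r (O (s.rarr a)) }
  | .seq c c', s => c'.denote O (c.denote O s)
  -- Arbitrary value, here and for loops: `denote` is used only for `Straight` programs.
  | .branch _ _ _, s => s
  | .loop _ _, s => s

/-- The number of steps of a program without branches and loops. -/
def steps : RAMProg → ℕ
  | .skip => 1
  | .nset _ e => 1 + e.cost
  | .rset _ e => 1 + e.cost
  | .nput _ p e => 1 + p.cost + e.cost
  | .rput _ p e => 1 + p.cost + e.cost
  | .query _ _ => 1
  | .seq c c' => c.steps + c'.steps
  | .branch _ _ _ => 0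
  | .loop _ _ => 0

theorem Straight.exec (O : (ℕ → ℝ) → ℝ) {c : RAMProg} (hc : c.Straight) (s : RAMState) :
    RAMExec O c s (c.denote O s) c.steps := by
  induction c generalizing s with
  | skip => exact .skip s
  | nset i e => exact .nset s i e
  | rset i e => exact .rset s i e
  | nput a p e => exact .nput s a p e
  | rput a p e => exact .rput s a p e
  | query r a => exact .query s r a
  | seq c c' ih ih' => exact .seq (ih hc.1 s) (ih' hc.2 _)
  | branch => exact hc.elim
  | loop => exact hc.elim

/-- Register `i` runs from `0` up to the value of register `b`. -/
def count (i b : ℕ) (c : RAMProg) : RAMProg :=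
  .seq (.nset i (.const 0))
    (.loop (.nlt (.reg i) (.reg b)) (.seq c (.nset i (.add (.reg i) (.const 1)))))

end RAMProg

namespace Meets
variable {O : (ℕ → ℝ) → ℝ} {c c' : RAMProg} {s : RAMState} {B B' : ℕ} {Q : RAMState → Prop}

theorem straight (hc : c.Straight) (hB : c.steps ≤ B) (hQ : Q (c.denote O s)) : Meets O c s B Q :=
  ⟨_, _, hc.exec O s, hB, hQ⟩

theorem mono {Q' : RAMState → Prop} (h : Meets O c s B Q) (hB : B ≤ B') (hQ : ∀ s, Q s → Q' s) :
    Meets O c s B' Q' :=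
  let ⟨s', t, h1, h2, h3⟩ := h
  ⟨s', t, h1, h2.trans hB, hQ _ h3⟩

theorem seq {R : RAMState → Prop} (h : Meets O c s B R) (h' : ∀ s', R s' → Meets O c' s' B' Q) :
    Meets O (.seq c c') s (B + B') Q :=
  let ⟨_, _, h1, h2, h3⟩ := h
  let ⟨s'', _, h1', h2', h3'⟩ := h' _ h3
  ⟨s'', _, h1.seq h1', Nat.add_le_add h2 h2', h3'⟩

/-- The invariant is indexed by the number of completed rounds, and the induction is on the rounds
left. The last summand pays for the final, failing test. -/
theorem loop {b : RAMTest} {Inv : ℕ → RAMState → Prop} (M B : ℕ)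
    (hb : ∀ k s, k ≤ M → Inv k s → (b.holds s ↔ k < M))
    (hc : ∀ k s, k < M → Inv k s → Meets O c s B (Inv (k + 1))) (h0 : Inv 0 s) :
    Meets O (.loop b c) s (M * (B + b.cost + 1) + b.cost + 1) (Inv M) := by
  have key : ∀ l k s, k + l = M → Inv k s →
      Meets O (.loop b c) s (l * (B + b.cost + 1) + b.cost + 1) (Inv M) := by
    intro l
    induction l with
    | zero =>
      intro k s hk h
      have hkM : k = M := by omega
      subst hkM
      exact ⟨s, _, .loop_done (by rw [hb k s le_rfl h]; exact lt_irrefl k), by omega, h⟩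
    | succ l ih =>
      intro k s hk h
      obtain ⟨s', t, h1, h2, h3⟩ := hc k s (by omega) h
      obtain ⟨s'', t', h1', h2', h3'⟩ := ih (k + 1) s' (by omega) h3
      refine ⟨s'', _, .loop_step ((hb k s (by omega) h).2 (by omega)) h1 h1', ?_, h3'⟩
      rw [Nat.succ_mul]
      omega
  exact key M 0 s (by omega) h0

/-- Each round pays 3 for the test and 4 for the increment; initialisation (2) and the failing test
(3) give the final 5. By `hset` the invariant ignores the counter, which is tracked separately. -/
theorem count {i b : ℕ} {Inv : ℕ → RAMState → Prop} (M B : ℕ)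
    (hset : ∀ k s v, Inv k s → Inv k { s with nreg := Function.update s.nreg i v })
    (hb : ∀ k s, Inv k s → s.nreg b = M)
    (hc : ∀ k s, k < M → Inv k s → s.nreg i = k →
      Meets O c s B (fun s' => Inv (k + 1) s' ∧ s'.nreg i = k)) (h0 : Inv 0 s) :
    Meets O (.count i b c) s (M * (B + 7) + 5) (Inv M) := by
  refine (seq (c := .nset i (.const 0)) (B := 2) (B' := M * (B + 7) + 3)
    (R := fun s => Inv 0 s ∧ s.nreg i = 0) (straight trivial le_rfl ⟨hset 0 s _ h0, by simp [RAMProg.denote, NExp.eval]⟩)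
    fun s' hs' => ?_).mono (by omega) fun _ h => h
  refine (loop (Inv := fun k s => Inv k s ∧ s.nreg i = k) M (B + 4) ?_ ?_ hs').mono
    (le_of_eq (by simp only [RAMTest.cost, NExp.cost])) fun _ h => h.1
  · intro k s _ h
    simp [RAMTest.holds, NExp.eval, h.2, hb k s h.1]
  · intro k s hk h
    refine seq (hc k s hk h.1 h.2) fun s' hs' => straight trivial le_rfl ⟨hset _ _ _ hs'.1, ?_⟩
    simp [RAMProg.denote, NExp.eval, hs'.2]

end Meets

/-! ### The scheme on flat indices -/

/-- The next digit, cyclically (without branching, for truncated subtraction). -/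
def digitUp (n e : ℕ) : ℕ := (e + 1) * (1 - (e + 2 - n))

/-- The previous digit, cyclically. -/
def digitDown (n e : ℕ) : ℕ := (e - 1) + (1 - e) * (n - 1)

/-- `p` with its base-`n` digit number `i` replaced by `x`. -/
def setDigit (n i p x : ℕ) : ℕ := p + x * n ^ i - p / n ^ i % n * n ^ i

/-- The one-step operator of the scheme for data listed in the order of base-`n` numbers. -/
def flatStep (d n : ℕ) (r : ℝ) (v : ℕ → ℝ) (p : ℕ) : ℝ :=
  (1 - 2 * d * r) * v p + ∑ i ∈ Finset.range d,
    r * (v (setDigit n i p (digitUp n (p / n ^ i % n))) +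
      v (setDigit n i p (digitDown n (p / n ^ i % n))))

/-- For `e < n` the truncated difference `e + 2 - n` is a carry bit: 1 if `e = n - 1` and 0
otherwise. -/
theorem digitUp_eq {n e : ℕ} (he : e < n) : digitUp n e = (e + 1) % n := by
  unfold digitUp
  rcases Nat.lt_or_ge (e + 1) n with h | h
  · rw [Nat.mod_eq_of_lt h, show e + 2 - n = 0 by omega]; simp
  · obtain rfl : n = e + 1 := by omega
    rw [show e + 2 - (e + 1) = 1 by omega]; simp

/-- The same carry bit updates the quotient, so `divTable` gets each entry from the previous one
without division. -/
theorem succ_div_eq {n p : ℕ} (hn : 0 < n) : (p + 1) / n = p / n + (p % n + 2 - n) := by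
  have h := Nat.mod_lt p hn
  have h2 := Nat.div_add_mod p n
  rw [Nat.div_eq_iff hn]
  rcases Nat.lt_or_ge (p % n + 1) n with h' | h'
  · rw [show p % n + 2 - n = 0 by omega]
    rw [add_zero, mul_comm]; omega
  · rw [show p % n + 2 - n = 1 by omega, add_mul, mul_comm]; omega

/-! ### The programs -/

namespace FTCS
open RAMProg

/-- Computes `n` in register 0, `m` in register 1, `d` in register 2, `n ^ d` in register 3, and
`Δx` and `α Δt / Δx²` in the real registers 5 and 6. -/
def setup : RAMProg :=
  .seq (.seq (.nset 2 (.reg 0)) (.nset 0 (.const 0))) <|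
  .seq (.loop (.rlt
      (.mul (.mul (.cast (.const 3)) (.reg 4)) (.mul (.cast (.reg 0)) (.cast (.reg 0))))
      (.mul (.mul (.reg 0) (.reg 0))
        (.mul (.mul (.mul (.cast (.reg 2)) (.reg 2)) (.reg 3)) (.reg 1))))
    (.nset 0 (.add (.reg 0) (.const 1)))) <|
  .seq (.nset 1 (.const 0)) <|
  .seq (.loop (.rlt
      (.mul (.cast (.reg 1)) (.mul (.reg 0) (.reg 0)))
      (.mul (.mul (.mul (.mul (.cast (.const 2)) (.cast (.reg 2))) (.reg 2)) (.reg 1))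
        (.mul (.cast (.reg 0)) (.cast (.reg 0)))))
    (.nset 1 (.add (.reg 1) (.const 1)))) <|
  .seq (.nset 3 (.const 1)) <|
  .seq (.count 4 2 (.nset 3 (.mul (.reg 3) (.reg 0)))) <|
  .seq (.rset 5 (.div (.reg 0) (.cast (.reg 0))))
    (.rset 6 (.div (.mul (.reg 2) (.div (.reg 1) (.cast (.reg 1)))) (.mul (.reg 5) (.reg 5))))

/-- Tabulates `p % n` and `p / n` in the arrays 0 and 1. -/
def divTable : RAMProg :=
  .seq (.seq (.nput 0 (.const 0) (.const 0)) (.nput 1 (.const 0) (.const 0))) <|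
  .count 5 3 <|
  .seq (.nset 8 (.get 0 (.reg 5))) <|
  .seq (.nput 0 (.add (.reg 5) (.const 1))
    (.mul (.add (.reg 8) (.const 1))
      (.sub (.const 1) (.sub (.add (.reg 8) (.const 2)) (.reg 0)))))
    (.nput 1 (.add (.reg 5) (.const 1))
      (.add (.get 1 (.reg 5)) (.sub (.add (.reg 8) (.const 2)) (.reg 0))))

/-- Reads the initial values into the first block of the real array 0. -/
def readInitial : RAMProg :=
  .count 5 3 <|
  .seq (.nset 6 (.reg 5)) <|
  .seq (.count 4 2 <|
    .seq (.rput 1 (.reg 4) (.mul (.cast (.get 0 (.reg 6))) (.reg 5))) (.nset 6 (.get 1 (.reg 6)))) <|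
  .seq (.query 7 1) (.rput 0 (.reg 5) (.reg 7))

/-- Adds to real register 7 the contribution of the two neighbours in one direction. -/
def addNeighbours : RAMProg :=
  .seq (.nset 8 (.get 0 (.reg 6))) <|
  .seq (.rset 7 (.add (.reg 7) (.mul (.reg 6) (.add
    (.get 0 (.add (.mul (.reg 9) (.reg 3)) (.sub (.add (.reg 5) (.mul
      (.mul (.add (.reg 8) (.const 1))
        (.sub (.const 1) (.sub (.add (.reg 8) (.const 2)) (.reg 0)))) (.reg 7)))
      (.mul (.reg 8) (.reg 7)))))
    (.get 0 (.add (.mul (.reg 9) (.reg 3)) (.sub (.add (.reg 5) (.mul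
      (.add (.sub (.reg 8) (.const 1))
        (.mul (.sub (.const 1) (.reg 8)) (.sub (.reg 0) (.const 1)))) (.reg 7)))
      (.mul (.reg 8) (.reg 7))))))))) <|
  .seq (.nset 6 (.get 1 (.reg 6))) (.nset 7 (.mul (.reg 7) (.reg 0)))

/-- The new value at one grid point. -/
def pointStep : RAMProg :=
  .seq (.seq (.rset 7 (.mul
      (.sub (.cast (.const 1)) (.mul (.mul (.cast (.const 2)) (.cast (.reg 2))) (.reg 6)))
      (.get 0 (.add (.mul (.reg 9) (.reg 3)) (.reg 5)))))
    (.seq (.nset 6 (.reg 5)) (.nset 7 (.const 1)))) <|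
  .seq (.count 4 2 addNeighbours)
    (.rput 0 (.add (.mul (.add (.reg 9) (.const 1)) (.reg 3)) (.reg 5)) (.reg 7))

/-- The time steps. -/
def timeLoop : RAMProg := .count 9 1 (.count 5 3 pointStep)

def program : RAMProg := .seq setup (.seq divTable (.seq readInitial timeLoop))

/-- The constants that stay in the registers after the setup. -/
structure Consts (d n m : ℕ) (h r : ℝ) (s : RAMState) : Prop where
  n0 : s.nreg 0 = n
  n1 : s.nreg 1 = m
  n2 : s.nreg 2 = d
  n3 : s.nreg 3 = n ^ d
  r5 : s.rreg 5 = h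
  r6 : s.rreg 6 = r

/-- The arrays 0 and 1 hold the remainders and quotients. -/
def HasDivTable (n N : ℕ) (s : RAMState) : Prop :=
  ∀ p ≤ N, s.narr 0 p = p % n ∧ s.narr 1 p = p / n

variable {O : (ℕ → ℝ) → ℝ} {s : RAMState}

/-- `hn` and `hm` are the loop tests, cleared of the root and of the quotients: counting up from 0
stops exactly at `n` and at `m`. -/
theorem setup_meets {d : ℕ} {L T α ζ ε : ℝ} {n m : ℕ}
    (hn : ∀ k : ℕ, 3 * ε * (k * k : ℝ) < L * L * (d * α * ζ * T) ↔ k < n)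
    (hm : ∀ k : ℕ, k * (L * L) < 2 * d * α * T * (n * n : ℝ) ↔ k < m) :
    Meets O setup (heatInput d L T α ζ ε) (n * 30 + m * 30 + d * 30 + 200)
      (Consts d n m (L / n) (α * (T / m) / (L / n) ^ 2)) := by
  -- The summands are generous budgets for the consecutive pieces of `setup`.
  have h0 : Meets O setup (heatInput d L T α ζ ε)
    (5 + ((n * (5 + 24) + 24) + (3 + ((m * 27 + 23) + (3 + ((d * (5 + 7) + 5) + 100))))))
      (Consts d n m (L / n) (α * (T / m) / (L / n) ^ 2)) := by
    have hr : ∀ s : RAMState, s.rreg = (heatInput d L T α ζ ε).rreg → s.rreg 0 = L ∧ s.rreg 1 = T ∧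
        s.rreg 2 = α ∧ s.rreg 3 = ζ ∧ s.rreg 4 = ε := by
      intro s hs
      simp [hs, heatInput]
    refine Meets.seq (R := fun s => s.nreg 0 = 0 ∧ s.nreg 2 = d ∧
      s.rreg = (heatInput d L T α ζ ε).rreg)
      (.straight ⟨trivial, trivial⟩ (by decide) (by simp [denote, NExp.eval, heatInput])) ?_
    intro s h
    refine Meets.seq (R := fun s => s.nreg 0 = n ∧ s.nreg 2 = d ∧
      s.rreg = (heatInput d L T α ζ ε).rreg)
      ((Meets.loop (Inv := fun k s => s.nreg 0 = k ∧ s.nreg 2 = d ∧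
      s.rreg = (heatInput d L T α ζ ε).rreg) n 4 ?_ ?_ h).mono ?_ fun _ h => h) ?_
    · rintro k s - ⟨h1, h2, h3⟩
      obtain ⟨g0, g1, g2, g3, g4⟩ := hr s h3
      simpa [RAMTest.holds, RExp.eval, NExp.eval, h1, h2, g0, g1, g2, g3, g4] using hn k
    · rintro k s - ⟨h1, h2, h3⟩
      exact .straight trivial (by decide) (by simp [denote, NExp.eval, h1, h2, h3])
    · simp only [RAMTest.cost, NExp.cost, RExp.cost]; omega
    intro s h
    refine Meets.seq (R := fun s => s.nreg 1 = 0 ∧ s.nreg 0 = n ∧ s.nreg 2 = d ∧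
      s.rreg = (heatInput d L T α ζ ε).rreg)
      (.straight trivial (by decide) (by simp [denote, NExp.eval, h])) ?_
    intro s h
    refine Meets.seq (R := fun s => s.nreg 1 = m ∧ s.nreg 0 = n ∧ s.nreg 2 = d ∧
      s.rreg = (heatInput d L T α ζ ε).rreg)
      ((Meets.loop (Inv := fun k s => s.nreg 1 = k ∧ s.nreg 0 = n ∧ s.nreg 2 = d ∧
      s.rreg = (heatInput d L T α ζ ε).rreg) m 4 ?_ ?_ h).mono ?_ fun _ h => h) ?_
    · rintro k s - ⟨h0, h1, h2, h3⟩
      obtain ⟨g0, g1, g2, g3, g4⟩ := hr s h3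
      simpa [RAMTest.holds, RExp.eval, NExp.eval, h0, h1, h2, g0, g1, g2, g3, g4] using hm k
    · rintro k s - ⟨h0, h1, h2, h3⟩
      exact .straight trivial (by decide) (by simp [denote, NExp.eval, h0, h1, h2, h3])
    · simp only [RAMTest.cost, NExp.cost, RExp.cost]; omega
    intro s h
    refine Meets.seq (R := fun s => s.nreg 3 = n ^ 0 ∧ s.nreg 1 = m ∧ s.nreg 0 = n ∧
      s.nreg 2 = d ∧ s.rreg = (heatInput d L T α ζ ε).rreg)
      (.straight trivial (by decide) (by simp [denote, NExp.eval, h])) ?_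
    intro s h
    refine Meets.seq (R := fun s => s.nreg 3 = n ^ d ∧ s.nreg 1 = m ∧ s.nreg 0 = n ∧
      s.nreg 2 = d ∧ s.rreg = (heatInput d L T α ζ ε).rreg)
      (Meets.count (Inv := fun k s => s.nreg 3 = n ^ k ∧ s.nreg 1 = m ∧ s.nreg 0 = n ∧
      s.nreg 2 = d ∧ s.rreg = (heatInput d L T α ζ ε).rreg) d 5 ?_ ?_ ?_ h) ?_
    · intro k s v h
      simpa using h
    · exact fun k s h => h.2.2.2.1
    · rintro k s - h hk
      exact .straight trivial (by decide) (by simp [denote, NExp.eval, h, hk, pow_succ])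
    intro s h
    obtain ⟨g0, g1, g2, g3, g4⟩ := hr s h.2.2.2.2
    refine .straight ⟨trivial, trivial⟩ (by decide) ?_
    constructor <;> simp [denote, NExp.eval, RExp.eval, h.1, h.2.1, h.2.2.1, h.2.2.2.1, g0, g1, g2, sq]
  exact h0.mono (by omega) fun _ h => h

theorem divTable_meets {d n m : ℕ} {h r : ℝ} (hn : 0 < n) (hs : Consts d n m h r s) :
    Meets O divTable s (n ^ d * 50 + 50)
      (fun s => Consts d n m h r s ∧ HasDivTable n (n ^ d) s) := by
  have h0 : Meets O divTable s (10 + (n ^ d * (30 + 7) + 5))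
      (fun s => Consts d n m h r s ∧ HasDivTable n (n ^ d) s) := by
    refine Meets.seq (R := fun s => Consts d n m h r s ∧ HasDivTable n 0 s)
      (.straight ⟨trivial, trivial⟩ (by decide) ⟨⟨hs.n0, hs.n1, hs.n2, hs.n3, hs.r5, hs.r6⟩, ?_⟩) ?_
    · intro p hp
      obtain rfl : p = 0 := by omega
      simp [denote, NExp.eval]
    intro s hs
    refine Meets.count (Inv := fun k s => Consts d n m h r s ∧ HasDivTable n k s) (n ^ d) 30
      ?_ ?_ ?_ hs
    · rintro k s v ⟨h1, h2⟩
      exact ⟨⟨by simp [h1.n0], by simp [h1.n1], by simp [h1.n2], by simp [h1.n3], h1.r5, h1.r6⟩, h2⟩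
    · exact fun k s h => h.1.n3
    · rintro k s - ⟨h1, h2⟩ hk
      refine .straight ⟨trivial, trivial, trivial⟩ (by decide) ⟨⟨⟨?_, ?_, ?_, ?_, ?_, ?_⟩, ?_⟩, ?_⟩
      · simp [denote, h1.n0]
      · simp [denote, h1.n1]
      · simp [denote, h1.n2]
      · simp [denote, h1.n3]
      · simp [denote, h1.r5]
      · simp [denote, h1.r6]
      · intro p hp
        have h3 := h2 k le_rfl
        rcases Nat.lt_or_ge k p with h | h
        · obtain rfl : p = k + 1 := by omega
          have e1 := digitUp_eq (Nat.mod_lt k hn)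
          rw [Nat.mod_add_mod, digitUp] at e1
          simp [denote, NExp.eval, hk, h3, h1.n0, e1, succ_div_eq hn]
        · have hpk : p ≠ k + 1 := by omega
          simpa [denote, NExp.eval, hk, hpk] using h2 p h
      · simp [denote, hk]
  exact h0.mono (by omega) fun _ h => h

end FTCS

/-! ### Sampling the initial data, base-`n` digits, and time stepping -/

namespace FTCS
open RAMProg
variable {O : (ℕ → ℝ) → ℝ} {s : RAMState}

theorem Consts.update_nreg {d n m : ℕ} {h r : ℝ} (hs : Consts d n m h r s) {i : ℕ} (hi : 3 < i)
    (v : ℕ) : Consts d n m h r { s with nreg := Function.update s.nreg i v } := by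
  constructor
  · simpa [Function.update_apply, show 0 ≠ i by omega] using hs.n0
  · simpa [Function.update_apply, show 1 ≠ i by omega] using hs.n1
  · simpa [Function.update_apply, show 2 ≠ i by omega] using hs.n2
  · simpa [Function.update_apply, show 3 ≠ i by omega] using hs.n3
  · exact hs.r5
  · exact hs.r6

theorem Consts.update_rreg {d n m : ℕ} {h r : ℝ} (hs : Consts d n m h r s) {i : ℕ} (hi : 6 < i)
    (v : ℝ) : Consts d n m h r { s with rreg := Function.update s.rreg i v } := by
  refine ⟨hs.n0, hs.n1, hs.n2, hs.n3, ?_, ?_⟩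
  · simpa [Function.update_apply, show 5 ≠ i by omega] using hs.r5
  · simpa [Function.update_apply, show 6 ≠ i by omega] using hs.r6

theorem Consts.congr_rarr {d n m : ℕ} {h r : ℝ} (hs : Consts d n m h r s) (A : ℕ → ℕ → ℝ) :
    Consts d n m h r { s with rarr := A } :=
  ⟨hs.n0, hs.n1, hs.n2, hs.n3, hs.r5, hs.r6⟩

theorem div_pow_le_pow {n d p : ℕ} (hp : p < n ^ d) (i : ℕ) : p / n ^ i ≤ n ^ d :=
  (Nat.div_le_self _ _).trans hp.le

/-- Repeated table lookup of quotients peels off the digits of `p`, which are the grid coordinates.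
`hO` is needed because the invariant describes only the first `d` entries of the query array. -/
theorem readInitial_meets {d n m : ℕ} {h r : ℝ}
    (hO : ∀ z z' : ℕ → ℝ, (∀ i < d, z i = z' i) → O z = O z')
    (hs : Consts d n m h r s) (ht : HasDivTable n (n ^ d) s) :
    Meets O readInitial s (n ^ d * (d * 30 + 60) + 50)
      (fun s => Consts d n m h r s ∧ HasDivTable n (n ^ d) s ∧
        ∀ p < n ^ d, s.rarr 0 p = O fun i => (p / n ^ i % n : ℕ) * h) := by
  have h0 : Meets O readInitial s (n ^ d * ((2 + ((d * (11 + 7) + 5) + 10)) + 7) + 5)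
      (fun s => Consts d n m h r s ∧ HasDivTable n (n ^ d) s ∧
        ∀ p < n ^ d, s.rarr 0 p = O fun i => (p / n ^ i % n : ℕ) * h) := by
    refine Meets.count (Inv := fun k s => Consts d n m h r s ∧ HasDivTable n (n ^ d) s ∧
        ∀ p < k, s.rarr 0 p = O fun i => (p / n ^ i % n : ℕ) * h) (n ^ d) _
      ?_ ?_ ?_ ⟨hs, ht, by simp⟩
    · rintro k s v ⟨h1, h2, h3⟩
      exact ⟨h1.update_nreg (by decide) _, h2, h3⟩
    · exact fun k s h => h.1.n3
    rintro p s hp ⟨h1, h2, h3⟩ hk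
    refine Meets.seq (R := fun s => Consts d n m h r s ∧ HasDivTable n (n ^ d) s ∧
        (∀ p' < p, s.rarr 0 p' = O fun i => (p' / n ^ i % n : ℕ) * h) ∧ s.nreg 5 = p ∧
        s.nreg 6 = p / n ^ 0 ∧ ∀ i < 0, s.rarr 1 i = (p / n ^ i % n : ℕ) * h)
      (.straight trivial (by decide)
        ⟨h1.update_nreg (by decide) _, h2, h3, by simpa [denote] using hk,
          by simpa [denote, NExp.eval] using hk, by simp⟩) ?_
    intro s hs
    refine Meets.seq (Meets.count (Inv := fun k s => Consts d n m h r s ∧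
        HasDivTable n (n ^ d) s ∧
        (∀ p' < p, s.rarr 0 p' = O fun i => (p' / n ^ i % n : ℕ) * h) ∧ s.nreg 5 = p ∧
        s.nreg 6 = p / n ^ k ∧ ∀ i < k, s.rarr 1 i = (p / n ^ i % n : ℕ) * h) d 11
        ?_ ?_ ?_ hs) ?_
    · rintro k s v ⟨h1, h2, h3, h4, h5, h6⟩
      exact ⟨h1.update_nreg (by decide) _, h2, h3, by simpa using h4, by simpa using h5, h6⟩
    · exact fun k s h => h.1.n2
    · rintro k s hk ⟨h1, h2, h3, h4, h5, h6⟩ hk'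
      have h7 := h2 _ (div_pow_le_pow hp k)
      refine .straight ⟨trivial, trivial⟩ (by decide)
        ⟨⟨(h1.congr_rarr _).update_nreg (by decide) _, h2, ?_, ?_, ?_, ?_⟩, ?_⟩
      · intro p' hp'
        simpa [denote] using h3 p' hp'
      · simpa [denote] using h4
      · simp [denote, NExp.eval, h5, h7, pow_succ, Nat.div_div_eq_div_mul]
      · intro i hi
        rcases Nat.lt_or_ge i k with h | h
        · simpa [denote, NExp.eval, hk', h.ne] using h6 i h
        · obtain rfl : i = k := by omega
          simp [denote, NExp.eval, RExp.eval, hk', h5, h7, h1.r5]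
      · simpa [denote] using hk'
    rintro s ⟨h1, h2, h3, h4, h5, h6⟩
    refine .straight ⟨trivial, trivial⟩ (by decide)
        ⟨⟨(h1.update_rreg (by decide) _).congr_rarr _, h2, ?_⟩, ?_⟩
    · intro p' hp'
      rcases Nat.lt_or_ge p' p with h | h
      · simpa [denote, NExp.eval, h4, h.ne] using h3 p' h
      · obtain rfl : p' = p := by omega
        simpa [denote, NExp.eval, RExp.eval, h4] using hO _ _ h6
    · simpa [denote] using h4
  refine h0.mono ?_ fun _ h => h
  have : (2 + ((d * (11 + 7) + 5) + 10)) + 7 ≤ d * 30 + 60 := by omega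
  have := Nat.mul_le_mul_left (n ^ d) this
  omega

theorem digitUp_lt {n e : ℕ} (he : e < n) : digitUp n e < n := by
  rw [digitUp_eq he]; exact Nat.mod_lt _ (by omega)

theorem digitDown_lt {n e : ℕ} (he : e < n) : digitDown n e < n := by
  unfold digitDown
  rcases Nat.eq_zero_or_pos e with rfl | h
  · simp; omega
  · rw [show 1 - e = 0 by omega]; omega

/-- The index of the grid point `k`. -/
def encode {d n : ℕ} (k : Fin d → Fin n) : ℕ := ∑ i, (k i : ℕ) * n ^ (i : ℕ)

theorem encode_eq {d n : ℕ} (k : Fin d → Fin n) : encode k = finFunctionFinEquiv k :=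
  (finFunctionFinEquiv_apply k).symm

theorem encode_lt {d n : ℕ} (k : Fin d → Fin n) : encode k < n ^ d := by
  rw [encode_eq]; exact (finFunctionFinEquiv k).2

theorem encode_digit {d n : ℕ} (k : Fin d → Fin n) (i : Fin d) :
    encode k / n ^ (i : ℕ) % n = k i := by
  have := finFunctionFinEquiv_symm_apply_val (finFunctionFinEquiv k) i
  rw [Equiv.symm_apply_apply] at this
  rw [encode_eq, this]

theorem exists_encode {d n p : ℕ} (hp : p < n ^ d) : ∃ k : Fin d → Fin n, encode k = p :=
  ⟨finFunctionFinEquiv.symm ⟨p, hp⟩, by rw [encode_eq, Equiv.apply_symm_apply]⟩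

/-- Both encodings agree off digit `i`. Since `setDigit` adds the new digit before removing the old
one, truncated subtraction is exact. -/
theorem setDigit_encode {d n : ℕ} (k : Fin d → Fin n) (i : Fin d) (x : Fin n) :
    setDigit n i (encode k) x = encode (Function.update k i x) := by
  unfold setDigit
  rw [encode_digit]
  have h1 := Finset.sum_erase_add Finset.univ (fun i : Fin d => (k i : ℕ) * n ^ (i : ℕ))
    (Finset.mem_univ i)
  have h2 := Finset.sum_erase_add Finset.univ
    (fun j : Fin d => (Function.update k i x j : ℕ) * n ^ (j : ℕ)) (Finset.mem_univ i)
  have h3 : ∑ j ∈ Finset.univ.erase i, (Function.update k i x j : ℕ) * n ^ (j : ℕ) =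
      ∑ j ∈ Finset.univ.erase i, (k j : ℕ) * n ^ (j : ℕ) :=
    Finset.sum_congr rfl fun j hj => by rw [Function.update_of_ne (Finset.ne_of_mem_erase hj)]
  rw [h3] at h2
  simp only [Function.update_self] at h2
  unfold encode
  omega

theorem setDigit_lt {d n p i x : ℕ} (hp : p < n ^ d) (hi : i < d) (hx : x < n) :
    setDigit n i p x < n ^ d := by
  obtain ⟨k, rfl⟩ := exists_encode hp
  exact setDigit_encode k ⟨i, hi⟩ ⟨x, hx⟩ ▸ encode_lt _

/-- The state of the computation of time level `j + 1`, done up to the grid point `p`. -/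
structure TimeState (d n m : ℕ) (h r : ℝ) (v : ℕ → ℝ) (j p : ℕ) (s : RAMState) : Prop where
  consts : Consts d n m h r s
  divTable : HasDivTable n (n ^ d) s
  levels : ∀ j' ≤ j, ∀ p < n ^ d, s.rarr 0 (j' * n ^ d + p) = (flatStep d n r)^[j'] v p
  partialLevel : ∀ p' < p, s.rarr 0 ((j + 1) * n ^ d + p') = (flatStep d n r)^[j + 1] v p'
  n9 : s.nreg 9 = j

theorem TimeState.update_nreg {d n m : ℕ} {h r : ℝ} {v : ℕ → ℝ} {j p : ℕ}
    (hs : TimeState d n m h r v j p s) {i : ℕ} (hi : 3 < i) (hi9 : 9 ≠ i) (x : ℕ) :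
    TimeState d n m h r v j p { s with nreg := Function.update s.nreg i x } :=
  ⟨hs.consts.update_nreg hi _, hs.divTable, hs.levels, hs.partialLevel,
    by simpa [Function.update_apply, hi9] using hs.n9⟩

theorem TimeState.update_rreg {d n m : ℕ} {h r : ℝ} {v : ℕ → ℝ} {j p : ℕ}
    (hs : TimeState d n m h r v j p s) {i : ℕ} (hi : 6 < i) (x : ℝ) :
    TimeState d n m h r v j p { s with rreg := Function.update s.rreg i x } :=
  ⟨hs.consts.update_rreg hi _, hs.divTable, hs.levels, hs.partialLevel, hs.n9⟩

/-- After `k` directions, registers 6 and 7 hold `p / n ^ k` and `n ^ k`, enough to read and replace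
digit `k`; real register 7 holds the partial sum defining `flatStep`. -/
theorem neighbours_meets {d n m : ℕ} {h r : ℝ} {v : ℕ → ℝ} {j p : ℕ} (hn : 0 < n)
    (hp : p < n ^ d) (hs : TimeState d n m h r v j p s) (h5 : s.nreg 5 = p) (h6 : s.nreg 6 = p)
    (h7 : s.nreg 7 = 1)
    (hr7 : s.rreg 7 = (1 - 2 * d * r) * (flatStep d n r)^[j] v p) :
    Meets O (.count 4 2 addNeighbours) s (d * (80 + 7) + 5)
      (fun s => TimeState d n m h r v j p s ∧ s.nreg 5 = p ∧
        s.rreg 7 = (flatStep d n r)^[j + 1] v p) := by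
  rw [Function.iterate_succ_apply']
  set w := (flatStep d n r)^[j] v with hw
  have hd : ∀ i, p / n ^ i % n < n := fun i => Nat.mod_lt _ hn
  refine (Meets.count (Inv := fun k s => TimeState d n m h r v j p s ∧ s.nreg 5 = p ∧
    s.nreg 6 = p / n ^ k ∧ s.nreg 7 = n ^ k ∧
    s.rreg 7 = (1 - 2 * d * r) * w p + ∑ i ∈ Finset.range k,
      r * (w (setDigit n i p (digitUp n (p / n ^ i % n))) +
        w (setDigit n i p (digitDown n (p / n ^ i % n))))) d 80 ?_ ?_ ?_
        ⟨hs, h5, by simpa using h6, by simpa using h7, by simpa using hr7⟩).mono le_rfl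
        fun s h => ⟨h.1, h.2.1, h.2.2.2.2⟩
  · rintro k s v ⟨h1, h2, h3, h4, h5⟩
    exact ⟨h1.update_nreg (by decide) (by decide) _, by simpa using h2, by simpa using h3,
      by simpa using h4, h5⟩
  · exact fun k s h => h.1.consts.n2
  rintro k s hk ⟨h1, h6, h7, h8, h9⟩ hk'
  have g7 := h1.divTable _ (div_pow_le_pow hp k)
  have gu := h1.levels j le_rfl _ (setDigit_lt hp hk (digitUp_lt (hd k)))
  have gd := h1.levels j le_rfl _ (setDigit_lt hp hk (digitDown_lt (hd k)))
  rw [← hw] at gu gd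
  unfold addNeighbours
  refine .straight ⟨trivial, trivial, trivial, trivial⟩ (by decide)
    ⟨⟨(((h1.update_nreg (by decide) (by decide) _).update_rreg (by decide) _).update_nreg
      (by decide) (by decide) _).update_nreg (by decide) (by decide) _, ?_, ?_, ?_, ?_⟩, ?_⟩
  · simpa [denote] using h6
  · simp [denote, NExp.eval, h7, g7, pow_succ, Nat.div_div_eq_div_mul]
  · simp [denote, NExp.eval, h8, h1.consts.n0, pow_succ]
  · rw [Finset.sum_range_succ, ← add_assoc, ← h9, ← gu, ← gd]
    simp [denote, NExp.eval, RExp.eval, h1.n9, h6, h7, h8, g7, h1.consts.n0, h1.consts.n3,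
      h1.consts.r6, setDigit, digitUp, digitDown]
  · simpa [denote] using hk'

theorem pointStep_meets {d n m : ℕ} {h r : ℝ} {v : ℕ → ℝ} {j p : ℕ} (hn : 0 < n)
    (hp : p < n ^ d) (h1 : TimeState d n m h r v j p s) (hk : s.nreg 5 = p) :
    Meets O pointStep s (30 + ((d * (80 + 7) + 5) + 20))
      (fun s => TimeState d n m h r v j (p + 1) s ∧ s.nreg 5 = p) := by
  refine Meets.seq (R := fun s => TimeState d n m h r v j p s ∧ s.nreg 5 = p ∧ s.nreg 6 = p ∧
      s.nreg 7 = 1 ∧ s.rreg 7 = (1 - 2 * d * r) * (flatStep d n r)^[j] v p)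
    (.straight ⟨trivial, trivial, trivial⟩ (by decide)
      ⟨((h1.update_rreg (by decide) _).update_nreg (by decide) (by decide) _).update_nreg
        (by decide) (by decide) _, ?_, ?_, ?_, ?_⟩) ?_
  · simpa [denote] using hk
  · simpa [denote, NExp.eval] using hk
  · simp [denote, NExp.eval]
  · simp [denote, NExp.eval, RExp.eval, h1.consts.n2, h1.consts.n3, h1.consts.r6, hk, h1.n9,
      h1.levels j le_rfl p hp]
  rintro s ⟨h1, h5, h6, h7, h8⟩
  refine Meets.seq (neighbours_meets hn hp h1 h5 h6 h7 h8) ?_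
  clear h1 h5 h6 h7 h8
  rintro s ⟨⟨h1, h2, h3, h4, h5⟩, h6, h7⟩
  refine .straight trivial (by decide) ⟨⟨h1.congr_rarr _, h2, ?_, ?_, ?_⟩, ?_⟩
  · intro j' hj' p' hp'
    -- The write goes to a fresh level, so earlier levels survive.
    have : j' * n ^ d + p' ≠ (j + 1) * n ^ d + p := by
      have := Nat.mul_le_mul_right (n ^ d) hj'
      rw [add_mul]; omega
    simpa [denote, NExp.eval, h5, h6, h1.n3, this] using h3 j' hj' p' hp'
  · intro p' hp'
    rcases Nat.lt_or_ge p' p with h | h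
    · simpa [denote, NExp.eval, h5, h6, h1.n3, h.ne] using h4 p' h
    · have hpp : p' = p := by omega
      simp [denote, NExp.eval, RExp.eval, h5, h6, h1.n3, h7, hpp]
  · simpa [denote] using h5
  · simpa [denote] using h6

theorem timeLoop_meets {d n m : ℕ} {h r : ℝ} (hn : 0 < n) (v : ℕ → ℝ)
    (hs : Consts d n m h r s) (ht : HasDivTable n (n ^ d) s) (hv : ∀ p < n ^ d, s.rarr 0 p = v p) :
    Meets O timeLoop s (m * (n ^ d * (d * 100 + 100) + 100) + 5)
      (fun s => Consts d n m h r s ∧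
        ∀ j ≤ m, ∀ p < n ^ d, s.rarr 0 (j * n ^ d + p) = (flatStep d n r)^[j] v p) := by
  have h0 := Meets.count (O := O) (i := 9) (b := 1) (c := .count 5 3 pointStep) (s := s)
    (Inv := fun j s => Consts d n m h r s ∧ HasDivTable n (n ^ d) s ∧
      ∀ j' ≤ j, ∀ p < n ^ d, s.rarr 0 (j' * n ^ d + p) = (flatStep d n r)^[j'] v p) m
    (n ^ d * (d * 100 + 90 + 7) + 5) ?_ ?_ ?_ ⟨hs, ht, ?_⟩
  · refine h0.mono ?_ fun _ h => ⟨h.1, h.2.2⟩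
    gcongr ?_ + 5
    refine Nat.mul_le_mul_left m ?_
    have := Nat.mul_le_mul_left (n ^ d) (show d * 100 + 90 + 7 ≤ d * 100 + 100 by omega)
    omega
  · rintro k s v ⟨h1, h2, h3⟩
    exact ⟨h1.update_nreg (by decide) _, h2, h3⟩
  · exact fun k s h => h.1.n1
  · rintro j s - ⟨h1, h2, h3⟩ hj
    have := Meets.count (O := O) (i := 5) (b := 3) (Inv := TimeState d n m h r v j) (n ^ d)
      (d * 100 + 90)
      (fun k s v h => h.update_nreg (by decide) (by decide) _) (fun k s h => h.consts.n3)
      (fun p s hp h1 hk => (pointStep_meets hn hp h1 hk).mono (by omega) fun _ h => h)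
      ⟨h1, h2, h3, by simp, hj⟩
    refine this.mono (Nat.le_refl _) ?_
    rintro s ⟨h1, h2, h3, h4, h5⟩
    refine ⟨⟨h1, h2, fun j' hj' p hp => ?_⟩, h5⟩
    -- At `p = n ^ d` the partial level `j + 1` is complete and joins the finished ones.
    rcases Nat.lt_or_ge j j' with h | h
    · obtain rfl : j' = j + 1 := by omega
      exact h4 p hp
    · exact h3 j' h p hp
  · intro j hj p hp
    obtain rfl : j = 0 := by omega
    simpa using hv p hp

theorem program_meets {d : ℕ} {L T α ζ ε : ℝ} {n m : ℕ} (hd : 0 < d) (hn0 : 0 < n) (hm0 : 0 < m)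
    (hO : ∀ z z' : ℕ → ℝ, (∀ i < d, z i = z' i) → O z = O z')
    (hn : ∀ k : ℕ, 3 * ε * (k * k : ℝ) < L * L * (d * α * ζ * T) ↔ k < n)
    (hm : ∀ k : ℕ, k * (L * L) < 2 * d * α * T * (n * n : ℝ) ↔ k < m) :
    Meets O program (heatInput d L T α ζ ε) (1000 * (n ^ d * m * d))
      (fun s => s.nreg 0 = n ∧ s.nreg 1 = m ∧ ∀ j ≤ m, ∀ p < n ^ d,
        s.rarr 0 (j * n ^ d + p) = (flatStep d n (α * (T / m) / (L / n) ^ 2))^[j]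
          (fun p => O fun i => (p / n ^ i % n : ℕ) * (L / n)) p) := by
  refine ((setup_meets hn hm).seq fun s h1 => (divTable_meets hn0 h1).seq fun s h2 =>
    (readInitial_meets hO h2.1 h2.2).seq fun s h3 =>
    timeLoop_meets hn0 _ h3.1 h3.2.1 h3.2.2).mono ?_ fun s h => ⟨h.1.n0, h.1.n1, h.2⟩
  -- With this, every lower-order cost is absorbed into `n ^ d * m * d`.
  have hnN : n ≤ n ^ d := Nat.le_self_pow hd.ne' n
  generalize n ^ d = N at *
  have hN : 1 ≤ N := by omega
  have a1 : 1 ≤ N * m := Nat.mul_pos hN hm0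
  have a2 : N ≤ N * m := Nat.le_mul_of_pos_right _ hm0
  have a3 : m ≤ N * m := Nat.le_mul_of_pos_left _ hN
  have a4 : N * m ≤ N * m * d := Nat.le_mul_of_pos_right _ hd
  have a5 : N * d ≤ N * m * d := Nat.mul_le_mul_right d a2
  have a6 : d ≤ N * m * d := Nat.le_mul_of_pos_left _ a1
  have e1 : N * (d * 30 + 60) = 30 * (N * d) + 60 * N := by ring
  have e2 : m * (N * (d * 100 + 100) + 100) = 100 * (N * m * d) + 100 * (N * m) + 100 * m := by ring
  rw [e1, e2]
  omega

end FTCS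

/-! ### The scheme on the periodic grid -/

section grid
variable {d n : ℕ}

/-- The grid point `k - eᵢ`, cyclically. -/
def gridShiftBack (i : Fin d) (k : Fin d → Fin n) : Fin d → Fin n :=
  Function.update k i ((finRotate n).symm (k i))

theorem val_finRotate (a : Fin n) : (finRotate n a : ℕ) = (a + 1) % n := by
  cases n with
  | zero => exact a.elim0
  | succ n => rw [finRotate_apply, Fin.val_add, Fin.val_one']; simp

/-- Turns the second indicator in `ftcsStep` into a condition on the column index, so that the
matrix-vector sum collapses. -/
theorem gridShift_eq_iff (i : Fin d) (k k' : Fin d → Fin n) :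
    k = gridShift i k' ↔ k' = gridShiftBack i k := by
  unfold gridShift gridShiftBack
  constructor
  · rintro rfl
    rw [Function.update_self, Equiv.symm_apply_apply, Function.update_idem,
      Function.update_eq_self]
  · rintro rfl
    rw [Function.update_self, Equiv.apply_symm_apply, Function.update_idem,
      Function.update_eq_self]

theorem ftcsStep_mulVec (r : ℝ) (w : (Fin d → Fin n) → ℝ) (k : Fin d → Fin n) :
    (ftcsStep d n r).mulVec w k = (1 - 2 * d * r) * w k +
      ∑ i, r * (w (gridShift i k) + w (gridShiftBack i k)) := by
  simp only [Matrix.mulVec, dotProduct, ftcsStep, fun i k' => gridShift_eq_iff i k k']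
  simp only [add_mul _ _ (w _), Finset.sum_mul]
  rw [Finset.sum_add_distrib, Finset.sum_comm]
  congr 1
  · simp
  · refine Finset.sum_congr rfl fun i _ => ?_
    rw [Finset.sum_add_distrib]
    simp [mul_add]

namespace FTCS

theorem digitDown_eq (a : Fin n) : digitDown n a = ((finRotate n).symm a : Fin n) := by
  have ha := a.2
  have h : (finRotate n).symm a = ⟨digitDown n a, digitDown_lt ha⟩ := by
    rw [Equiv.symm_apply_eq]
    ext
    rw [val_finRotate]
    simp only [digitDown]
    rcases Nat.eq_zero_or_pos (a : ℕ) with h | h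
    · rw [h]; simp [Nat.sub_add_cancel (show 1 ≤ n by omega)]
    · rw [show 1 - (a : ℕ) = 0 by omega, zero_mul, add_zero, Nat.sub_add_cancel h,
        Nat.mod_eq_of_lt ha]
  rw [h]

/-- The bridge from the machine's address arithmetic to the matrix of the scheme. -/
theorem flatStep_encode (r : ℝ) (v : ℕ → ℝ) (k : Fin d → Fin n) :
    flatStep d n r v (encode k) = (ftcsStep d n r).mulVec (fun k => v (encode k)) k := by
  rw [ftcsStep_mulVec, flatStep, ← Fin.sum_univ_eq_sum_range (fun i =>
    r * (v (setDigit n i (encode k) (digitUp n (encode k / n ^ i % n))) +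
      v (setDigit n i (encode k) (digitDown n (encode k / n ^ i % n)))))]
  congr 1
  refine Finset.sum_congr rfl fun i _ => ?_
  rw [encode_digit, digitUp_eq (k i).2, ← val_finRotate, digitDown_eq, setDigit_encode,
    setDigit_encode]
  rfl

end FTCS

/-- Forward substitution solves the block system. -/
theorem ftcsMatrix_mulVec_of_step {m : ℕ} (r : ℝ) (V : ℕ → (Fin d → Fin n) → ℝ)
    (hV : ∀ j, V (j + 1) = (ftcsStep d n r).mulVec (V j)) :
    (ftcsMatrix d n m r).mulVec (fun p => V (p.1 + 1) p.2) = ftcsRhs d n m r (V 0) := by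
  funext ⟨j, k⟩
  -- Diagonal and subdiagonal positions are disjoint, so the nested conditional is a sum.
  have h1 : ∀ q : Fin m × (Fin d → Fin n), ftcsMatrix d n m r (j, k) q =
      (if q = (j, k) then 1 else 0) +
        (if (j : ℕ) = q.1 + 1 then - ftcsStep d n r k q.2 else 0) := by
    intro q
    unfold ftcsMatrix
    by_cases h : (j, k) = q
    · subst h; simp
    · rw [if_neg h, if_neg (Ne.symm h), zero_add]
  simp only [Matrix.mulVec, dotProduct, h1, add_mul, Finset.sum_add_distrib, ite_mul, one_mul,
    zero_mul, Finset.sum_ite_eq', Finset.mem_univ, if_true, ftcsRhs]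
  rw [Fintype.sum_prod_type, hV]
  rcases j with ⟨_ | j, hj⟩
  · simp [Matrix.mulVec, dotProduct]
  · have h2 : ∀ x : Fin m, (j + 1 = (x : ℕ) + 1) ↔ x = ⟨j, by omega⟩ := by
      intro x; rw [Fin.ext_iff]; simp only; omega
    simp only [h2, Finset.sum_ite_irrel, Finset.sum_const_zero, Finset.sum_ite_eq',
      Finset.mem_univ, if_true]
    simp [hV, Matrix.mulVec, dotProduct]

theorem periodic_congr {L : ℝ} {f : (Fin d → ℝ) → ℝ} (hf : ∀ x i, f (x + Pi.single i L) = f x)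
    {x y : Fin d → ℝ} (c : Fin d → ℤ) (h : ∀ i, x i = y i + c i * L) : f x = f y := by
  rw [← periodic_int_mul hf c y]
  congr 1
  funext i
  exact h i

theorem gridPoint_mod {L : ℝ} (hn : 0 < n) {f : (Fin d → ℝ) → ℝ}
    (hf : ∀ x i, f (x + Pi.single i L) = f x) (k : Fin d → ℕ) :
    f (gridPoint L n (fun i => k i % n)) = f (gridPoint L n k) := by
  have hn' : (n : ℝ) ≠ 0 := by positivity
  refine periodic_congr hf (fun i => -(k i / n : ℕ)) fun i => ?_
  have := congrArg (Nat.cast (R := ℝ)) (Nat.div_add_mod (k i) n)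
  simp only [gridPoint]
  simp only [Int.cast_neg, Int.cast_natCast, Nat.cast_add, Nat.cast_mul] at this ⊢
  rw [← this]
  field_simp
  ring

theorem gridPoint_gridShift {L : ℝ} (hn : 0 < n) {f : (Fin d → ℝ) → ℝ}
    (hf : ∀ x i, f (x + Pi.single i L) = f x) (i : Fin d) (k : Fin d → Fin n) :
    f (gridPoint L n (fun j => gridShift i k j)) =
      f (gridPoint L n (fun j => k j) + (L / n) • Pi.single i 1) := by
  have hn' : (n : ℝ) ≠ 0 := by positivity
  -- The quotient `(k i + 1) / n` is the number of periods by which the cyclic shift wraps around.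
  refine periodic_congr hf (Pi.single i (-((k i + 1) / n : ℕ))) fun j => ?_
  by_cases h : j = i
  · subst h
    have := congrArg (Nat.cast (R := ℝ)) (Nat.div_add_mod (k j + 1) n)
    simp only [gridPoint, gridShift, Function.update_self, val_finRotate, Pi.add_apply,
      Pi.smul_apply, Pi.single_eq_same, smul_eq_mul, mul_one]
    simp only [Int.cast_neg, Int.cast_natCast, Nat.cast_add, Nat.cast_mul, Nat.cast_one] at this ⊢
    field_simp
    linear_combination L * this
  · simp [gridPoint, gridShift, h]

/-- Follows from the forward shift applied to `f` translated by one mesh width. -/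
theorem gridPoint_gridShiftBack {L : ℝ} (hn : 0 < n) {f : (Fin d → ℝ) → ℝ}
    (hf : ∀ x i, f (x + Pi.single i L) = f x) (i : Fin d) (k : Fin d → Fin n) :
    f (gridPoint L n (fun j => gridShiftBack i k j)) =
      f (gridPoint L n (fun j => k j) + (-(L / n)) • Pi.single i 1) := by
  have hn' : (n : ℝ) ≠ 0 := by positivity
  obtain ⟨k', rfl⟩ : ∃ k', k = gridShift i k' := ⟨_, (gridShift_eq_iff i _ _).2 rfl⟩
  have h1 := gridPoint_gridShift (L := L) (n := n) (d := d)
    (f := fun x => f (x + (-(L / n)) • Pi.single i 1)) hn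
    (fun x j => by rw [add_right_comm, hf]) i k'
  rw [h1, ← (gridShift_eq_iff i _ _).1 rfl]
  congr 1
  rw [add_assoc, ← add_smul]
  simp

/-- Discrete maximum principle: the weights `1 - 2 d r` and `2 d` copies of `r` are nonnegative and
sum to 1. -/
theorem abs_ftcsStep_mulVec_le {r e : ℝ} (hr : 0 ≤ r) (hr' : 2 * d * r ≤ 1)
    {w : (Fin d → Fin n) → ℝ} (hw : ∀ k, |w k| ≤ e) (k : Fin d → Fin n) :
    |(ftcsStep d n r).mulVec w k| ≤ e := by
  rw [ftcsStep_mulVec]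
  refine (abs_add_le _ _).trans ?_
  have h1 : |(1 - 2 * d * r) * w k| ≤ (1 - 2 * d * r) * e := by
    rw [abs_mul, abs_of_nonneg (by linarith)]
    exact mul_le_mul_of_nonneg_left (hw k) (by linarith)
  have h2 : |∑ i, r * (w (gridShift i k) + w (gridShiftBack i k))| ≤ d * (r * (e + e)) := by
    refine (Finset.abs_sum_le_sum_abs _ _).trans ?_
    refine (Finset.sum_le_card_nsmul _ _ (r * (e + e)) fun i _ => ?_).trans (by simp)
    rw [abs_mul, abs_of_nonneg hr]
    exact mul_le_mul_of_nonneg_left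
      ((abs_add_le _ _).trans (add_le_add (hw _) (hw _))) hr
  linarith

end grid

/-- Convergence of the scheme in the maximum norm. -/
theorem abs_ftcs_sub_le {d n : ℕ} {L T α ζ δ : ℝ} {u : (Fin d → ℝ) → ℝ → ℝ} (hL : 0 < L)
    (hα : 0 < α) (hn : 0 < n) (hu : IsPeriodicHeatSolution L T α u)
    (hζ : FourthDerivBound L T ζ u) (hδ : 0 ≤ δ) (hr : 2 * d * (α * δ / (L / n) ^ 2) ≤ 1)
    (V : ℕ → (Fin d → Fin n) → ℝ) (h0 : ∀ k, V 0 k = u (gridPoint L n fun i => k i) 0)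
    (hV : ∀ j, V (j + 1) = (ftcsStep d n (α * δ / (L / n) ^ 2)).mulVec (V j))
    (j : ℕ) (hj : j * δ ≤ T) (k : Fin d → Fin n) :
    |V j k - u (gridPoint L n fun i => k i) (j * δ)| ≤
      j * (α * d * (ζ / L ^ d) * δ * (α * d * δ / 2 + (L / n) ^ 2 / 12)) := by
  have hn' : (0 : ℝ) < n := by positivity
  have hh : 0 < L / n := by positivity
  set r := α * δ / (L / n) ^ 2 with hrdef
  have hr0 : 0 ≤ r := by positivity
  induction j generalizing k with
  | zero => simp [h0]
  | succ j ih =>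
    push_cast at hj ⊢
    have ht0 : 0 ≤ j * δ := by positivity
    have htT : j * δ ∈ Icc 0 T := ⟨ht0, by linarith⟩
    set U : (Fin d → Fin n) → ℝ := fun k => u (gridPoint L n fun i => k i) (j * δ) with hU
    -- By linearity the old error is propagated without growth; truncation adds one new summand.
    have h1 := abs_ftcsStep_mulVec_le hr0 hr (w := V j - U) (fun k => ih (by linarith) k) k
    have h2 := abs_truncation_le hL hα hu hζ (gridPoint L n fun i => k i) ht0 hδ
      (by linarith : j * δ + δ ≤ T) hh
    have h3 : (ftcsStep d n r).mulVec U k = u (gridPoint L n fun i => k i) (j * δ) +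
        r * ∑ i, secondDiff i (L / n) (fun y => u y (j * δ)) (gridPoint L n fun i => k i) := by
      rw [ftcsStep_mulVec]
      simp only [hU]
      have hp := hu.periodic (j * δ) htT
      have e1 := fun i => gridPoint_gridShift (f := fun y => u y (j * δ)) hn hp i k
      have e2 := fun i => gridPoint_gridShiftBack (f := fun y => u y (j * δ)) hn hp i k
      simp only [e1, e2, secondDiff, Finset.sum_sub_distrib, Finset.sum_const, Finset.card_univ,
        Fintype.card_fin, nsmul_eq_mul, ← Finset.mul_sum]
      ring
    rw [Matrix.mulVec_sub, Pi.sub_apply, h3, ← hV] at h1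
    rw [show (j + 1 : ℝ) * δ = j * δ + δ by ring]
    rw [abs_le] at h1 h2 ⊢
    constructor <;> linarith

/-! ### The running time -/

section time
variable {d : ℕ} {L T α ζ ε : ℝ}

/-- The claimed time factors as `n̄ ^ d * (3 / 2 * m̄) ^ (3 / 2) * d` times the logarithm. As `m̄ ≥
1`, the power is at least `m̄`, and the logarithm stays away from 0. -/
theorem linEqTime_ge (hd : 0 < d) (hL : 0 < L) (hT : 0 < T) (hα : 0 < α) (hζ : 0 < ζ)
    (hε : 0 < ε) (hε1 : ε < 1) (hm : 1 ≤ timeSteps d T α ζ ε) :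
    spaceSteps d L T α ζ ε ^ d * timeSteps d T α ζ ε * d / 6 ≤ linEqTime d L T α ζ ε := by
  have hd' : (0 : ℝ) < d := by positivity
  set M := timeSteps d T α ζ ε with hM
  have e1 : linEqTime d L T α ζ ε = spaceSteps d L T α ζ ε ^ d * (3 / 2 * M) ^ (3 / 2 : ℝ) * d *
      Real.log (T * d * α * √ζ / ε) := by
    have hA : spaceSteps d L T α ζ ε ^ d = L ^ d * ((3 : ℝ) ^ (-(d : ℝ) / 2) *
        T ^ ((d : ℝ) / 2) * (ζ / ε) ^ ((d : ℝ) / 2) * (d : ℝ) ^ ((d : ℝ) / 2) *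
        α ^ ((d : ℝ) / 2)) := by
      rw [spaceSteps, mul_pow, Real.sqrt_eq_rpow, ← Real.rpow_natCast (_ ^ (1 / 2 : ℝ)),
        ← Real.rpow_mul (by positivity),
        show (d * α * ζ * T / (3 * ε)) = 3⁻¹ * T * (ζ / ε) * d * α by field_simp,
        Real.mul_rpow (by positivity) hα.le, Real.mul_rpow (by positivity) hd'.le,
        Real.mul_rpow (by positivity) (by positivity), Real.mul_rpow (by positivity) hT.le,
        show (1 / 2 * (d : ℝ)) = d / 2 by ring, Real.inv_rpow (by norm_num),
        ← Real.rpow_neg (by norm_num), neg_div]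
    have hB : (3 / 2 * M) ^ (3 / 2 : ℝ) = T ^ 3 * (d : ℝ) ^ 3 * α ^ 3 * (ζ / ε) ^ (3 / 2 : ℝ) := by
      have : 3 / 2 * M = (T * d * α) ^ 2 * (ζ / ε) := by
        rw [hM, timeSteps]; field_simp
      rw [this, Real.mul_rpow (by positivity) (by positivity), ← Real.rpow_natCast,
        ← Real.rpow_mul (by positivity), show ((2 : ℕ) : ℝ) * (3 / 2) = (3 : ℕ) by norm_num,
        Real.rpow_natCast]
      ring
    have hp : ∀ x : ℝ, 0 < x → x ^ ((d : ℝ) / 2 + 3) = x ^ ((d : ℝ) / 2) * x ^ 3 := by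
      intro x hx
      rw [Real.rpow_add hx, Real.rpow_ofNat]
    have hp4 : (d : ℝ) ^ ((d : ℝ) / 2 + 4) = (d : ℝ) ^ ((d : ℝ) / 2) * (d : ℝ) ^ 4 := by
      rw [Real.rpow_add hd', Real.rpow_ofNat]
    rw [linEqTime, hA, hB, hp T hT, hp α hα, hp4, Real.rpow_add (by positivity) (_ / _)]
    ring
  have e2 : M ≤ (3 / 2 * M) ^ (3 / 2 : ℝ) :=
    (by linarith : M ≤ 3 / 2 * M).trans (Real.self_le_rpow_of_one_le (by linarith) (by norm_num))
  -- The squared argument is `3 / 2 * M / ε ≥ 3 / 2`, and `log (3 / 2) ≥ 1 - 2 / 3`; halving gives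
  -- `1 / 6`.
  have e3 : 1 / 6 ≤ Real.log (T * d * α * √ζ / ε) := by
    have hy : (T * d * α * √ζ / ε) ^ 2 = 3 / 2 * M / ε := by
      rw [div_pow, mul_pow, Real.sq_sqrt hζ.le, hM, timeSteps]
      field_simp
    have hy1 : 3 / 2 ≤ (T * d * α * √ζ / ε) ^ 2 := by
      rw [hy, le_div_iff₀ hε]; nlinarith
    have h1 := Real.one_sub_inv_le_log_of_pos (show (0 : ℝ) < 3 / 2 by norm_num)
    have h2 := Real.log_le_log (by norm_num) hy1
    rw [Real.log_pow] at h2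
    norm_num at h1 h2
    linarith
  rw [e1]
  have hA : 0 ≤ spaceSteps d L T α ζ ε ^ d := by unfold spaceSteps; positivity
  have hM0 : 0 ≤ M := by linarith
  calc _ = spaceSteps d L T α ζ ε ^ d * M * d * (1 / 6) := by ring
    _ ≤ _ := by gcongr

theorem spaceSteps_sq_mul_eq (hL : 0 < L) (hT : 0 < T) (hα : 0 < α) (hζ : 0 < ζ) (hε : 0 < ε) :
    spaceSteps d L T α ζ ε ^ 2 * (3 * ε) = L ^ 2 * (d * α * ζ * T) := by
  rw [spaceSteps, mul_pow, Real.sq_sqrt (by positivity)]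
  field_simp

theorem spaceSteps_pos (hd : 0 < d) (hL : 0 < L) (hT : 0 < T) (hα : 0 < α) (hζ : 0 < ζ)
    (hε : 0 < ε) : 0 < spaceSteps d L T α ζ ε := by
  have hd' : (0 : ℝ) < d := by positivity
  unfold spaceSteps; positivity

theorem lt_gridN_iff (hd : 0 < d) (hL : 0 < L) (hT : 0 < T) (hα : 0 < α) (hζ : 0 < ζ)
    (hε : 0 < ε) (k : ℕ) :
    3 * ε * (k * k : ℝ) < L * L * (d * α * ζ * T) ↔ k < gridN d L T α ζ ε := by
  have h0 := spaceSteps_pos hd hL hT hα hζ hε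
  have h : (k : ℝ) ^ 2 * (3 * ε) < spaceSteps d L T α ζ ε ^ 2 * (3 * ε) ↔
      (k : ℝ) ^ 2 < spaceSteps d L T α ζ ε ^ 2 := mul_lt_mul_iff_left₀ (by positivity)
  rw [gridN, Nat.lt_ceil, ← pow_lt_pow_iff_left₀ (Nat.cast_nonneg k) h0.le two_ne_zero, ← h,
    spaceSteps_sq_mul_eq hL hT hα hζ hε]
  ring_nf

theorem lt_gridM_iff (hL : 0 < L) (k : ℕ) :
    k * (L * L) < 2 * d * α * T * (gridN d L T α ζ ε * gridN d L T α ζ ε : ℝ) ↔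
      k < gridM d L T α ζ ε := by
  rw [gridM, Nat.lt_ceil, lt_div_iff₀ (by positivity), sq, sq]

theorem gridN_pow_mul_gridM_le {K : ℝ} (hd : 0 < d) (hL : 0 < L) (hT : 0 < T) (hα : 0 < α)
    (hζ : 0 < ζ) (hε : 0 < ε) (hm : 1 ≤ timeSteps d T α ζ ε)
    (hK : (gridN d L T α ζ ε : ℝ) ^ d ≤ K * spaceSteps d L T α ζ ε ^ d) :
    (gridN d L T α ζ ε : ℝ) ^ d * gridM d L T α ζ ε ≤
      2 * max K 1 ^ 3 * (spaceSteps d L T α ζ ε ^ d * timeSteps d T α ζ ε) := by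
  set A := spaceSteps d L T α ζ ε with hA
  set M := timeSteps d T α ζ ε with hM
  set n := gridN d L T α ζ ε with hn
  set Q := max K 1 with hQ
  have hA0 : 0 < A := spaceSteps_pos hd hL hT hα hζ hε
  have hAn : A ≤ n := Nat.le_ceil _
  have hQ1 : 1 ≤ Q := le_max_right _ _
  have hK' : (n : ℝ) ^ d ≤ Q * A ^ d :=
    hK.trans (mul_le_mul_of_nonneg_right (le_max_left _ _) (by positivity))
  -- Since `n / A ≥ 1` and `d ≥ 1`, the ratio is at most its `d`-th power. This controls `n ^ 2`,
  -- hence `m`.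
  have h1 : (n : ℝ) / A ≤ Q := by
    have h2 : ((n : ℝ) / A) ^ d ≤ Q := by
      rw [div_pow, div_le_iff₀ (by positivity)]; exact hK'
    exact (le_self_pow₀ ((one_le_div hA0).2 hAn) hd.ne').trans h2
  have h2 : (n : ℝ) ≤ Q * A := (div_le_iff₀ hA0).1 h1
  have h3 : 2 * d * α * T * (n : ℝ) ^ 2 / L ^ 2 ≤ Q ^ 2 * M := by
    have : M = 2 * d * α * T * A ^ 2 / L ^ 2 := by
      have := spaceSteps_sq_mul_eq (d := d) hL hT hα hζ hε
      rw [← hA] at this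
      rw [hM, timeSteps]
      field_simp
      linear_combination -this
    rw [this, mul_div_assoc', div_le_div_iff_of_pos_right (by positivity)]
    have h4 : (n : ℝ) ^ 2 ≤ (Q * A) ^ 2 := by gcongr
    calc 2 * d * α * T * (n : ℝ) ^ 2 ≤ 2 * d * α * T * (Q * A) ^ 2 := by gcongr
      _ = _ := by ring
  have h4 : (gridM d L T α ζ ε : ℝ) ≤ 2 * Q ^ 2 * M := by
    have h5 := (Nat.ceil_lt_add_one
      (show 0 ≤ 2 * d * α * T * (n : ℝ) ^ 2 / L ^ 2 by positivity)).le
    have h6 : 1 ≤ Q ^ 2 * M := one_le_mul_of_one_le_of_one_le (one_le_pow₀ hQ1) hm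
    change (⌈2 * d * α * T * (n : ℝ) ^ 2 / L ^ 2⌉₊ : ℝ) ≤ _
    linarith
  calc (n : ℝ) ^ d * gridM d L T α ζ ε ≤ (Q * A ^ d) * (2 * Q ^ 2 * M) := by gcongr
    _ = _ := by ring

/-- The mesh is fine enough. -/
theorem total_error_le (hd : 0 < d) (hL : 0 < L) (hT : 0 < T) (hα : 0 < α) (hζ : 0 < ζ)
    (hε : 0 < ε) {n δ : ℝ} (hn : spaceSteps d L T α ζ ε ≤ n)
    (hr : 2 * d * (α * δ / (L / n) ^ 2) ≤ 1) :
    T * (α * d * (ζ / L ^ d) * (α * d * δ / 2 + (L / n) ^ 2 / 12)) ≤ ε / L ^ d := by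
  have h0 := spaceSteps_pos hd hL hT hα hζ hε
  have hn0 : 0 < n := h0.trans_le hn
  have hh : 0 < (L / n) ^ 2 := by positivity
  have h1 : 2 * d * (α * δ) ≤ (L / n) ^ 2 := by
    rw [mul_div_assoc', div_le_one hh] at hr; exact hr
  -- Stability bounds the time part by a quarter of `(L / n) ^ 2`, and `1 / 4 + 1 / 12 = 1 / 3`: the
  -- source of the 3 in `spaceSteps`.
  have h2 : α * d * δ / 2 + (L / n) ^ 2 / 12 ≤ (L / n) ^ 2 / 3 := by linarith
  have h3 : L ^ 2 * (d * α * ζ * T) ≤ n ^ 2 * (3 * ε) := by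
    rw [← spaceSteps_sq_mul_eq hL hT hα hζ hε]; gcongr
  calc T * (α * d * (ζ / L ^ d) * (α * d * δ / 2 + (L / n) ^ 2 / 12)) ≤
      T * (α * d * (ζ / L ^ d) * ((L / n) ^ 2 / 3)) := by gcongr
    _ = (L ^ 2 * (d * α * ζ * T)) / (n ^ 2 * 3) / L ^ d := by field_simp
    _ ≤ _ := by
      gcongr
      rw [div_le_iff₀ (by positivity)]
      linarith

end time

/-! ### Assembly: running time, accuracy, block system -/

theorem mainTheorem9 :
    ∃ P : RAMProg, ∀ K : ℝ, ∃ C : ℝ,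
      ∀ (d : ℕ) (L T α ζ ε : ℝ) (u : (Fin d → ℝ) → ℝ → ℝ),
        0 < d → 0 < L → 0 < T → 0 < α → 0 < ζ → 0 < ε → ε < 1 →
        IsPeriodicHeatSolution L T α u →
        FourthDerivBound L T ζ u →
        1 ≤ timeSteps d T α ζ ε →
        (gridN d L T α ζ ε : ℝ) ^ d ≤ K * spaceSteps d L T α ζ ε ^ d →
        let n := gridN d L T α ζ ε
        let m := gridM d L T α ζ ε
        let r := α * (T / m) / (L / n) ^ 2
        ∃ (s : RAMState) (t : ℕ),
          RAMExec (fun z => u (fun i => z i) 0) P (heatInput d L T α ζ ε) s t ∧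
          (t : ℝ) ≤ C * linEqTime d L T α ζ ε ∧
          s.nreg 0 = n ∧ s.nreg 1 = m ∧
          (∀ (j : ℕ) (k : Fin d → ℕ), j ≤ m → (∀ i, k i ≤ n) →
            |readGrid s n j k - u (gridPoint L n k) (j * (T / m))| ≤ ε / L ^ d) ∧
          (∃ w : Fin m × (Fin d → Fin n) → ℝ,
            (ftcsMatrix d n m r).mulVec w =
              ftcsRhs d n m r (fun k => u (gridPoint L n (fun i => k i)) 0) ∧
            √(∑ p, (readGrid s n (p.1 + 1) (fun i => p.2 i) - w p) ^ 2) ≤ ε / L ^ d) := by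
  -- The factors come from `FTCS.program_meets`, `gridN_pow_mul_gridM_le` and `linEqTime_ge`.
  refine ⟨FTCS.program, fun K => ⟨1000 * (2 * max K 1 ^ 3) * 6, ?_⟩⟩
  intro d L T α ζ ε u hd hL hT hα hζ hε hε1 hu hb hM hK n m r
  have hd' : (0 : ℝ) < d := by positivity
  have hA0 := spaceSteps_pos hd hL hT hα hζ hε
  have hn0 : 0 < n := Nat.ceil_pos.2 hA0
  have hn0' : (0 : ℝ) < n := by exact_mod_cast hn0
  have hm0 : 0 < m := Nat.ceil_pos.2 (by positivity)
  have hm0' : (0 : ℝ) < m := by exact_mod_cast hm0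
  obtain ⟨s, t, hexec, ht, hsn, hsm, hs⟩ := FTCS.program_meets
    (O := fun z => u (fun i => z i) 0) hd hn0 hm0
    (fun z z' h => congrArg (fun x => u x 0) (funext fun i => h i i.2))
    (lt_gridN_iff hd hL hT hα hζ hε) (lt_gridM_iff hL)
  set v : ℕ → ℝ := fun p => u (fun i : Fin d => (p / n ^ (i : ℕ) % n : ℕ) * (L / n)) 0 with hv
  set V : ℕ → (Fin d → Fin n) → ℝ := fun j k => (flatStep d n r)^[j] v (FTCS.encode k) with hVdef
  have hV0 : ∀ k, V 0 k = u (gridPoint L n fun i => k i) 0 := by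
    intro k
    simp only [hVdef, hv, Function.iterate_zero, id_eq, FTCS.encode_digit]
    rfl
  have hV : ∀ j, V (j + 1) = (ftcsStep d n r).mulVec (V j) := by
    intro j
    funext k
    simp only [hVdef, Function.iterate_succ_apply', FTCS.flatStep_encode]
  have hread : ∀ (j : ℕ), j ≤ m → ∀ k : Fin d → ℕ,
      readGrid s n j k = V j fun i => ⟨k i % n, Nat.mod_lt _ hn0⟩ :=
    fun j hj k => hs j hj _ (FTCS.encode_lt fun i => ⟨k i % n, Nat.mod_lt _ hn0⟩)
  have hr : 2 * d * r ≤ 1 := by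
    have h1 : 2 * d * α * T * (n : ℝ) ^ 2 / L ^ 2 ≤ m := Nat.le_ceil _
    rw [div_le_iff₀ (by positivity)] at h1
    rw [show 2 * d * r = 2 * d * α * T * (n : ℝ) ^ 2 / (m * L ^ 2) by
      simp only [r]; field_simp, div_le_one (by positivity)]
    exact h1
  have hε' : 0 ≤ ε / L ^ d := by positivity
  refine ⟨s, t, hexec, ?_, hsn, hsm, ?_, ?_⟩
  · have h1 : (t : ℝ) ≤ 1000 * ((n : ℝ) ^ d * m * d) := by exact_mod_cast ht
    have h2 := gridN_pow_mul_gridM_le hd hL hT hα hζ hε hM hK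
    have h3 := linEqTime_ge hd hL hT hα hζ hε hε1 hM
    calc (t : ℝ) ≤ 1000 * ((n : ℝ) ^ d * m * d) := h1
      _ ≤ 1000 * (2 * max K 1 ^ 3 * (spaceSteps d L T α ζ ε ^ d * timeSteps d T α ζ ε) * d) := by
        gcongr
      _ = 1000 * (2 * max K 1 ^ 3) * 6 *
          (spaceSteps d L T α ζ ε ^ d * timeSteps d T α ζ ε * d / 6) := by ring
      _ ≤ _ := by gcongr
  · intro j k hj _
    have hjm : (j : ℝ) ≤ m := by exact_mod_cast hj
    have hjT : j * (T / m) ≤ T := by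
      rw [mul_div_assoc', div_le_iff₀ hm0', mul_comm]; gcongr
    have h1 := abs_ftcs_sub_le hL hα hn0 hu hb (by positivity) hr V hV0 hV j hjT
      fun i => ⟨k i % n, Nat.mod_lt _ hn0⟩
    rw [hread j hj, ← gridPoint_mod (f := fun y => u y (j * (T / m))) hn0
      (hu.periodic _ ⟨by positivity, hjT⟩)]
    refine h1.trans (le_trans ?_ (total_error_le (n := n) hd hL hT hα hζ hε (Nat.le_ceil _) hr))
    calc _ = (j * (T / m)) * (α * d * (ζ / L ^ d) * (α * d * (T / m) / 2 + (L / n) ^ 2 / 12)) := by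
          ring
      _ ≤ _ := by gcongr
  -- The output itself solves the system, so the `ℓ₂` distance is 0.
  · refine ⟨fun p => V (p.1 + 1) p.2, ?_, ?_⟩
    · rw [ftcsMatrix_mulVec_of_step r V hV, funext hV0]
    · have : ∀ p : Fin m × (Fin d → Fin n),
          readGrid s n (p.1 + 1) (fun i => p.2 i) = V (p.1 + 1) p.2 := by
        intro p
        rw [hread _ p.1.2]
        congr 1
        funext i
        exact Fin.ext (Nat.mod_eq_of_lt (p.2 i).2)
      simpa [this] using hε'
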